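/- All graphs are finite and simple. A graph $H$ is a \emph{topological minor} of a graph $G$ if some subgraph of $G$ is a subdivision of $H$, that is, can be obtained from $H$ by replacing the edges of $H$ by internally disjoint paths. A graph $G$ is \emph{$(k,d)$-colourable} if each vertex can be assigned one of $k$ colours so that every vertex has at most $d$ neighbours of its own colour. It is \emph{$(k,d)$-choosable} if, for every assignment of a set $L(v)$ of exactly $k$ colours to each vertex $v$, one can choose a colour from $L(v)$ for each vertex $v$ so that every vertex has at most $d$ neighbours of its own colour. The \emph{defective chromatic number} (respectively, \emph{defective choice number}) of a class $\mathcal{C}$ of graphs is the minimum integer $k\geq 0$ for which there is an integer $d\geq 0$ such that every graph in $\mathcal{C}$ is $(k,d)$-colourable (respectively, $(k,d)$-choosable). \textbf{Theorem.} For all integers $t\geq s\geq 1$, the class of graphs that do not contain the complete bipartite graph $K_{s,t}$ as a topological minor has defective chromatic number equal to $s$ and defective choice number equal to $s$. Moreover, there is an absolute constant $C>0$ such that for all integers $t\geq s\geq 1$ there is an integer $d$ with $0\leq d\leq 2^{C s\log t}$ such that every graph with no $K_{s,t}$ topological minor is $(s,d)$-choosable. -/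

import Mathlib

universe u v

namespace DefectiveColouring

/-- The subgraph `S` of `G` is a subdivision of `H`: it is obtained from `H` by replacing each edge
`uv` by a path `P u v` between the branch vertices `f u` and `f v`, where the inner vertices of
the paths are not branch vertices and are not shared by the paths of two distinct edges. -/
def IsSubdivision {V : Type u} {W : Type v} {G : SimpleGraph V}
    (S : G.Subgraph) (H : SimpleGraph W) : Prop :=
  ∃ (f : W → V) (P : ∀ a b : W, H.Adj a b → G.Walk (f a) (f b)),
    Function.Injective f ∧
    (∀ a b (h : H.Adj a b), (P a b h).IsPath) ∧
    (∀ a b (h : H.Adj a b), P b a h.symm = (P a b h).reverse) ∧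
    (∀ a b (h : H.Adj a b) (w : W), f w ∈ (P a b h).support → w = a ∨ w = b) ∧
    (∀ a b (h : H.Adj a b) a' b' (h' : H.Adj a' b'), s(a, b) ≠ s(a', b') →
      ∀ x, x ∈ (P a b h).support → x ∈ (P a' b' h').support → x ∈ Set.range f) ∧
    (∀ x, x ∈ S.verts ↔
      x ∈ Set.range f ∨ ∃ a b, ∃ h : H.Adj a b, x ∈ (P a b h).support) ∧
    (∀ x y, S.Adj x y ↔ ∃ a b, ∃ h : H.Adj a b, s(x, y) ∈ (P a b h).edges)

/-- `H` is a topological minor of `G`: some subgraph of `G` is a subdivision of `H`. -/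
def IsTopologicalMinor {V : Type u} {W : Type v} (H : SimpleGraph W) (G : SimpleGraph V) : Prop :=
  ∃ S : G.Subgraph, IsSubdivision S H

/-- The colouring `c` of `G` has defect `d`: every vertex has at most `d` neighbours of its own
colour. -/
def HasDefect {V : Type u} {α : Type v} (G : SimpleGraph V) (c : V → α) (d : ℕ) : Prop :=
  ∀ x : V, {y | G.Adj x y ∧ c y = c x}.encard ≤ d

/-- `G` is `(k, d)`-colourable: `k`-colourable with defect `d`. -/
def IsColourable {V : Type u} (G : SimpleGraph V) (k d : ℕ) : Prop :=
  ∃ c : V → Fin k, HasDefect G c d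

/-- `G` is `(k, d)`-choosable: for every assignment `L` of lists of exactly `k` colours to the
vertices there is an `L`-colouring with defect `d`. -/
def IsChoosable {V : Type u} (G : SimpleGraph V) (k d : ℕ) : Prop :=
  ∀ (α : Type) (L : V → Finset α), (∀ x, (L x).card = k) →
    ∃ c : V → α, (∀ x, c x ∈ L x) ∧ HasDefect G c d

/-- A property of graphs. The class it stands for consists of the finite graphs that have it. -/
abbrev GraphClass : Type (u + 1) := ∀ V : Type u, SimpleGraph V → Prop

/-- `k` is the defective chromatic number of the class `𝒞` of finite graphs: the minimum `k` for
which there is some `d` such that every graph in `𝒞` is `(k, d)`-colourable. -/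
def IsDefectiveChromaticNumber (𝒞 : GraphClass.{u}) (k : ℕ) : Prop :=
  IsLeast {j : ℕ | ∃ d : ℕ, ∀ (V : Type u) [Finite V] (G : SimpleGraph V),
    𝒞 V G → IsColourable G j d} k

/-- `k` is the defective choice number of the class `𝒞` of finite graphs: the minimum `k` for
which there is some `d` such that every graph in `𝒞` is `(k, d)`-choosable. -/
def IsDefectiveChoiceNumber (𝒞 : GraphClass.{u}) (k : ℕ) : Prop :=
  IsLeast {j : ℕ | ∃ d : ℕ, ∀ (V : Type u) [Finite V] (G : SimpleGraph V),
    𝒞 V G → IsChoosable G j d} k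

/-- The graphs that do not have `K_{s,t}` as a topological minor. -/
def KstTopologicalMinorFree (s t : ℕ) : GraphClass.{u} :=
  fun _ G => ¬ IsTopologicalMinor (completeBipartiteGraph (Fin s) (Fin t)) G

end DefectiveColouring

/-!
A dense graph contains a subdivision of `H`, with a bound linear in the size of `H`. By an idea of
Mader, a minimal dense vertex set has large minimum degree and no small separations, so it is massed
around any choice of branch vertices and of distinct neighbours of theirs, one for each end of an
edge of `H`. A massed pair is linked (Thomas and Wollan): in a minimal counterexample no edge can be
contracted and no part can be replaced by a clique on its boundary, so any two adjacent vertices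
have many common neighbours, hence the closed neighbourhood of a vertex of small degree is linked,
and Menger's theorem carries the paths from the boundary to it.

Now let `G` have no `K_{s,t}` topological minor, let `B` be the set of its vertices of large degree,
and suppose that every vertex that is not isolated has at least `s` neighbours and no edge joins two
vertices of small degree, so that the vertices of small degree have `s` neighbours in `B`. Join
pairs of vertices of `B` by paths of length two through distinct vertices of small degree, as long
as new pairs can be joined. The graph of joined pairs is sparse, so it has linearly many edges and
linearly many cliques on `s` vertices; the neighbours in `B` of a vertex of small degree that is not
used form a clique, and fewer than `t` of these vertices share a clique on `s` vertices. So there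
are few vertices of small degree, which contradicts the sparsity of `G`. Hence a graph in the class
that has an edge has a vertex with between one and `s - 1` neighbours or an edge with both ends of
small degree, and removing that vertex or that edge gives an induction for choosability.

For the lower bound, consider the closure of a rooted tree with `s` levels in which every vertex has
`d + 1` children. Fewer than `s` colours do not suffice for defect `d`, since below every vertex
there is a child whose descendants avoid the colour of that vertex. Of any `s + t` vertices two are
incomparable, and their common ancestors, fewer than `s` in number, separate them, whereas fewer
than `s` vertices do not separate two branch vertices of a subdivision of `K_{s,t}`.
-/

namespace DefectiveColouring

open Finset
open scoped Classical

noncomputable section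

section Reachability

variable {V : Type u} {W : Type v}

theorem reachable_map_of_forall_adj {F : SimpleGraph V} {F' : SimpleGraph W} (π : V → W)
    (h : ∀ a b, F.Adj a b → F'.Reachable (π a) (π b)) {x y : V} (hxy : F.Reachable x y) :
    F'.Reachable (π x) (π y) := by
  obtain ⟨p⟩ := hxy
  induction p with
  | nil => rfl
  | cons hab _ ih => exact (h _ _ hab).trans ih

theorem reachable_of_forall_adj {F F' : SimpleGraph V}
    (h : ∀ a b, F.Adj a b → F'.Reachable a b) {x y : V} (hxy : F.Reachable x y) :
    F'.Reachable x y :=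
  reachable_map_of_forall_adj id h hxy

theorem eq_of_reachable {F : SimpleGraph V} {l : V → W} (h : ∀ a b, F.Adj a b → l a = l b)
    {x y : V} (hxy : F.Reachable x y) : l x = l y :=
  SimpleGraph.reachable_bot.1
    (reachable_map_of_forall_adj l (fun a b hab => SimpleGraph.reachable_bot.2 (h a b hab)) hxy)

end Reachability

/-! ### Linked sets -/

section Linked

variable {V : Type u} {α : Type*}

/-- The graph of the edges of `G` that lie within `S` and whose ends have the same label. -/
def monochromatic (G : SimpleGraph V) (S : Finset V) (l : V → α) : SimpleGraph V where
  Adj a b := G.Adj a b ∧ a ∈ S ∧ b ∈ S ∧ l a = l b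
  symm := ⟨fun _ _ h => ⟨h.1.symm, h.2.2.1, h.2.1, h.2.2.2.symm⟩⟩
  loopless := ⟨fun _ h => h.1.ne rfl⟩

theorem monochromatic_mono {G G' : SimpleGraph V} (hG : G ≤ G') {S S' : Finset V} (hS : S ⊆ S')
    {l l' : V → α} (hl : ∀ v ∈ S, l' v = l v) : monochromatic G S l ≤ monochromatic G' S' l' :=
  fun a b ⟨hab, ha, hb, hlab⟩ => ⟨hG hab, hS ha, hS hb, by rw [hl a ha, hl b hb, hlab]⟩

theorem reachable_monochromatic_of_walk {G : SimpleGraph V} {S : Finset V} {l : V → α} {k : α}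
    {x y : V} (p : G.Walk x y) (hS : ∀ v ∈ p.support, v ∈ S) (hl : ∀ v ∈ p.support, l v = k) :
    (monochromatic G S l).Reachable x y := by
  induction p with
  | nil => rfl
  | cons hab p ih =>
    simp only [SimpleGraph.Walk.support_cons, List.mem_cons, forall_eq_or_imp] at hS hl
    have hstart := p.start_mem_support
    exact (SimpleGraph.Adj.reachable (G := monochromatic G S l)
      ⟨hab, hS.1, hS.2 _ hstart, hl.1.trans (hl.2 _ hstart).symm⟩).trans (ih hS.2 hl.2)

/-- `Y` is linked in `S`: every labelling of `Y` extends to `S` so that any two vertices of `Y` with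
the same label are joined by a path in `S` all of whose vertices have that label. -/
def Linked (G : SimpleGraph V) (S Y : Finset V) : Prop :=
  ∀ c : V → ℕ, ∃ l : V → ℕ, (∀ y ∈ Y, l y = c y) ∧
    ∀ x ∈ Y, ∀ y ∈ Y, c x = c y → (monochromatic G S l).Reachable x y

theorem Linked.mono {G G' : SimpleGraph V} {S S' Y : Finset V} (h : Linked G S Y) (hG : G ≤ G')
    (hS : S ⊆ S') : Linked G' S' Y := fun c => by
  obtain ⟨l, hl, hreach⟩ := h c
  exact ⟨l, hl, fun x hx y hy hxy =>
    (hreach x hx y hy hxy).mono (monochromatic_mono hG hS fun _ _ => rfl)⟩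

theorem Linked.subset {G : SimpleGraph V} {S Y Y' : Finset V} (h : Linked G S Y) (hY : Y' ⊆ Y) :
    Linked G S Y' := fun c => by
  obtain ⟨l, hl, hreach⟩ := h c
  exact ⟨l, fun y hy => hl y (hY hy), fun x hx y hy => hreach x (hY hx) y (hY hy)⟩

end Linked

/-! ### Boundaries, and the deletion of an edge -/

section Boundary

variable {V : Type u}

/-- The graph of the edges of `G` that avoid the set `D`. -/
def avoid (G : SimpleGraph V) (D : Finset V) : SimpleGraph V where
  Adj a b := G.Adj a b ∧ a ∉ D ∧ b ∉ D
  symm := ⟨fun _ _ h => ⟨h.1.symm, h.2.2, h.2.1⟩⟩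
  loopless := ⟨fun _ h => h.1.ne rfl⟩

theorem avoid_le (G : SimpleGraph V) (D : Finset V) : avoid G D ≤ G := fun _ _ h => h.1

variable [Fintype V] {G : SimpleGraph V} {D : Finset V}

/-- The outer boundary of `D`: the vertices outside `D` that have a neighbour in `D`. -/
def boundary (G : SimpleGraph V) (D : Finset V) : Finset V :=
  {v | v ∉ D ∧ ∃ d ∈ D, G.Adj d v}

theorem mem_boundary {v : V} : v ∈ boundary G D ↔ v ∉ D ∧ ∃ d ∈ D, G.Adj d v := by
  simp [boundary]

theorem disjoint_boundary (G : SimpleGraph V) (D : Finset V) : Disjoint D (boundary G D) :=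
  disjoint_right.2 fun _ hv => (mem_boundary.1 hv).1

theorem boundary_empty (G : SimpleGraph V) : boundary G ∅ = ∅ := by
  simp [boundary]

theorem boundary_mono_left {G' : SimpleGraph V} (h : G ≤ G') (D : Finset V) :
    boundary G D ⊆ boundary G' D := fun _ hv =>
  have ⟨hvD, d, hd, hdv⟩ := mem_boundary.1 hv
  mem_boundary.2 ⟨hvD, d, hd, h hdv⟩

theorem boundary_deleteEdges_of_mem {a b : V} (ha : a ∈ D) (hb : b ∈ D) :
    boundary (G.deleteEdges {s(a, b)}) D = boundary G D := by
  refine (boundary_mono_left (G.deleteEdges_le _) D).antisymm fun v hv => ?_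
  obtain ⟨hvD, d, hd, hdv⟩ := mem_boundary.1 hv
  refine mem_boundary.2 ⟨hvD, d, hd, SimpleGraph.deleteEdges_adj.2 ⟨hdv, fun h => ?_⟩⟩
  rcases Sym2.eq_iff.1 h with ⟨-, rfl⟩ | ⟨-, rfl⟩
  exacts [hvD hb, hvD ha]

theorem exists_boundary_subset_insert_deleteEdges (G : SimpleGraph V) (D : Finset V) (a b : V) :
    ∃ z, boundary G D ⊆ insert z (boundary (G.deleteEdges {s(a, b)}) D) := by
  refine ⟨if a ∈ D then b else a, fun v hv => mem_insert.2 ?_⟩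
  obtain ⟨hvD, d, hd, hdv⟩ := mem_boundary.1 hv
  by_cases h : s(d, v) = s(a, b)
  · left
    rcases Sym2.eq_iff.1 h with ⟨rfl, rfl⟩ | ⟨rfl, rfl⟩
    exacts [(if_pos hd).symm, (if_neg hvD).symm]
  · exact Or.inr (mem_boundary.2 ⟨hvD, d, hd, SimpleGraph.deleteEdges_adj.2 ⟨hdv, h⟩⟩)

end Boundary

/-! ### Menger's theorem -/

section Menger

/-- The graph `P` is a linkage in `G` from `B` to `S`: the components of `P` lie in `E ∪ B`, each
meets `B` at most once, they join every vertex of `B` to a vertex of `S ⊆ T`, and they meet the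
target `T` only in `S`. The condition on `B` is encoded by a retraction `r` onto `B` that is
constant on the components. -/
structure Linkage {V : Type u} (G P : SimpleGraph V) (E T B S : Finset V) : Prop where
  le : P ≤ G
  mem_of_adj : ∀ a b, P.Adj a b → a ∈ E ∪ B
  mem_target : ∀ a b, P.Adj a b → a ∈ T → a ∈ S
  subset : S ⊆ T
  card_le : #S ≤ #B
  reachable : ∀ y ∈ B, ∃ z ∈ S, P.Reachable y z
  retraction : ∃ r : V → V, (∀ y ∈ B, r y = y) ∧ ∀ a b, P.Adj a b → r a = r b

variable {V : Type u} {G : SimpleGraph V} {E E' T : Finset V}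

theorem ncard_edgeSet_deleteEdges_lt [Finite V] {a b : V} (hab : G.Adj a b) :
    (G.deleteEdges {s(a, b)}).edgeSet.ncard < G.edgeSet.ncard := by
  refine Set.ncard_lt_ncard (SimpleGraph.edgeSet_ssubset_edgeSet.2
    (lt_of_le_of_ne (G.deleteEdges_le _) fun h => ?_))
  rw [← h, SimpleGraph.deleteEdges_adj] at hab
  exact hab.2 rfl

theorem Linkage.mono_left {G' P : SimpleGraph V} {B S : Finset V} (h : Linkage G P E T B S)
    (hG : G ≤ G') : Linkage G' P E T B S :=
  { h with le := h.le.trans hG }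

theorem Linkage.mem {P : SimpleGraph V} {B S : Finset V} (h : Linkage G P E T B S)
    {a : V} (haB : a ∈ B) (haT : a ∈ T) : a ∈ S := by
  obtain ⟨z, hz, hr⟩ := h.reachable a haB
  by_cases haz : a = z
  · exact haz ▸ hz
  · obtain ⟨w, hw⟩ := hr.nonempty_neighborSet_left haz
    exact h.mem_target a w hw haT

variable [Fintype V]

/-- The separator of the target `T` from the complement of `E` that `E` determines: the boundary of
`E` together with the part of `T` outside `E`. -/
def separator (G : SimpleGraph V) (T E : Finset V) : Finset V := boundary G E ∪ (T \ E)

theorem mem_separator {v : V} :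
    v ∈ separator G T E ↔ v ∉ E ∧ (v ∈ T ∨ ∃ d ∈ E, G.Adj d v) := by
  simp only [separator, mem_union, mem_boundary, mem_sdiff]
  by_cases h : v ∈ E <;> simp [h, or_comm]

theorem separator_subset_union (h : E' ⊆ E) : separator G T E' ⊆ E ∪ separator G T E := by
  intro a ha
  simp only [mem_separator, mem_union] at ha ⊢
  obtain ⟨-, haT | ⟨d, hd, hda⟩⟩ := ha
  · tauto
  · exact or_iff_not_imp_left.2 fun haE => ⟨haE, Or.inr ⟨d, h hd, hda⟩⟩

theorem separator_avoid (h : Disjoint E E') :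
    separator (avoid G E) (separator G T E) E' = separator G T (E ∪ E') := by
  ext v
  rw [Finset.disjoint_left] at h
  simp only [mem_separator, avoid, mem_union]
  constructor
  · rintro ⟨hvE', (⟨hvT, hvE⟩ | ⟨d, hdE', hdv, -, hvE⟩)⟩ <;> grind
  · rintro ⟨hv, (hvT | ⟨d, (hdE | hdE'), hdv⟩)⟩
    · grind
    · grind
    · exact ⟨by tauto, Or.inr ⟨d, hdE', hdv, fun hdE => h hdE hdE', by tauto⟩⟩

theorem Linkage.comp {P₁ P₂ : SimpleGraph V} {S₁ S₂ : Finset V} (hE : E' ⊆ E)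
    (hcard : #(separator G T E') ≤ #(separator G T E))
    (h₁ : Linkage (avoid G E') P₁ (E \ E') (separator G T E') (separator G T E) S₁)
    (h₂ : Linkage G P₂ E' T (separator G T E') S₂) :
    Linkage G (P₁ ⊔ P₂) E T (separator G T E) S₂ := by
  refine ⟨sup_le (h₁.le.trans (avoid_le G E')) h₂.le, ?_, ?_, h₂.subset, h₂.card_le.trans hcard,
    ?_, ?_⟩
  · rintro a b (h | h)
    · exact union_subset_union sdiff_subset subset_rfl (h₁.mem_of_adj a b h)
    · exact union_subset (hE.trans subset_union_left) (separator_subset_union hE)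
        (h₂.mem_of_adj a b h)
  · rintro a b (h | h) haT
    · exact h₂.mem (mem_separator.2 ⟨(h₁.le h).2.1, Or.inl haT⟩) haT
    · exact h₂.mem_target a b h haT
  · intro y hy
    obtain ⟨z, hz, hyz⟩ := h₁.reachable y hy
    obtain ⟨w, hw, hzw⟩ := h₂.reachable z (h₁.subset hz)
    exact ⟨w, hw, (hyz.mono le_sup_left).trans (hzw.mono le_sup_right)⟩
  · obtain ⟨r₁, hr₁, hP₁⟩ := h₁.retraction
    obtain ⟨r₂, hr₂, hP₂⟩ := h₂.retraction
    let r : V → V := fun a => if a ∈ E' ∪ separator G T E' then r₁ (r₂ a) else r₁ a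
    have r_eq_of_notMem : ∀ a ∉ E', r a = r₁ a := fun a ha =>
      ite_eq_right_iff.2 fun h => congrArg r₁ (hr₂ a ((mem_union.1 h).resolve_left ha))
    refine ⟨r, fun y hy => ?_, ?_⟩
    · rw [r_eq_of_notMem y fun h => (mem_separator.1 hy).1 (hE h), hr₁ y hy]
    · rintro a b (h | h)
      · rw [r_eq_of_notMem a (h₁.le h).2.1, r_eq_of_notMem b (h₁.le h).2.2, hP₁ a b h]
      · simp only [r, if_pos (h₂.mem_of_adj a b h), if_pos (h₂.mem_of_adj b a h.symm), hP₂ a b h]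

theorem card_le_card_neighbors_of_separator_minimal
    (hmin : ∀ E' ⊆ E, #(separator G T E) ≤ #(separator G T E'))
    (hindep : ∀ a ∈ E, ∀ b ∈ E, ¬ G.Adj a b) {A : Finset V} (hA : A ⊆ separator G T E \ T) :
    #A ≤ #{v ∈ E ∩ T | ∃ y ∈ A, G.Adj y v} := by
  let K : Finset V := {v ∈ E | ∃ y ∈ A, G.Adj y v}
  have hAsub : A ⊆ separator G T E := hA.trans sdiff_subset
  have hsub : separator G T (E \ K) ⊆ (separator G T E \ A) ∪ (T ∩ K) := by
    intro v hv
    obtain ⟨hvEK, hv⟩ := mem_separator.1 hv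
    by_cases hvE : v ∈ E
    · have hvK : v ∈ K := by simpa [hvE] using hvEK
      rcases hv with hvT | ⟨d, hd, hdv⟩
      · exact mem_union_right _ (mem_inter.2 ⟨hvT, hvK⟩)
      · exact absurd hdv (hindep d (mem_sdiff.1 hd).1 v hvE)
    · refine mem_union_left _ (mem_sdiff.2 ⟨mem_separator.2 ⟨hvE, ?_⟩, fun hvA => ?_⟩)
      · exact hv.imp_right fun ⟨d, hd, hdv⟩ => ⟨d, (mem_sdiff.1 hd).1, hdv⟩
      · rcases hv with hvT | ⟨d, hd, hdv⟩
        · exact (mem_sdiff.1 (hA hvA)).2 hvT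
        · obtain ⟨hdE, hdK⟩ := mem_sdiff.1 hd
          exact hdK (mem_filter.2 ⟨hdE, v, hvA, hdv.symm⟩)
  have hTK : T ∩ K = {v ∈ E ∩ T | ∃ y ∈ A, G.Adj y v} := by
    ext v; simp only [K, mem_inter, mem_filter]; tauto
  have hle := (hmin (E \ K) sdiff_subset).trans ((card_le_card hsub).trans (card_union_le _ _))
  have := card_sdiff_add_card_eq_card hAsub
  rw [hTK] at hle
  omega

theorem exists_matching_of_separator_minimal
    (hmin : ∀ E' ⊆ E, #(separator G T E) ≤ #(separator G T E'))
    (hindep : ∀ a ∈ E, ∀ b ∈ E, ¬ G.Adj a b) :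
    ∃ f : V → V, Set.InjOn f ↑(separator G T E \ T) ∧
      ∀ y ∈ separator G T E \ T, f y ∈ E ∩ T ∧ G.Adj y (f y) := by
  let N : ↥(separator G T E \ T) → Finset V := fun y => {v ∈ E ∩ T | G.Adj y v}
  have hall : ∀ A : Finset ↥(separator G T E \ T), #A ≤ #(A.biUnion N) := by
    intro A
    have hA : A.map (Function.Embedding.subtype _) ⊆ separator G T E \ T :=
      fun _ => property_of_mem_map_subtype A
    have hle := card_le_card_neighbors_of_separator_minimal hmin hindep hA
    rw [card_map] at hle
    refine hle.trans (card_le_card fun v hv => ?_)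
    obtain ⟨hvET, y, hy, hyv⟩ := mem_filter.1 hv
    obtain ⟨z, hz, rfl⟩ := mem_map.1 hy
    exact mem_biUnion.2 ⟨z, hz, mem_filter.2 ⟨hvET, hyv⟩⟩
  obtain ⟨f, hfinj, hf⟩ := (all_card_le_biUnion_card_iff_exists_injective N).1 hall
  refine ⟨fun y => if h : y ∈ separator G T E \ T then f ⟨y, h⟩ else y, ?_, ?_⟩
  · intro a ha b hb hab
    simp only [dif_pos (mem_coe.1 ha), dif_pos (mem_coe.1 hb)] at hab
    exact congrArg Subtype.val (hfinj hab)
  · intro y hy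
    simp only [dif_pos hy]
    exact mem_filter.1 (hf ⟨y, hy⟩)

theorem exists_linkage_of_matching {f : V → V} (hinj : Set.InjOn f ↑(separator G T E \ T))
    (hf : ∀ y ∈ separator G T E \ T, f y ∈ E ∩ T ∧ G.Adj y (f y)) :
    ∃ P S, Linkage G P E T (separator G T E) S := by
  set W := separator G T E \ T with hW
  let P : SimpleGraph V := SimpleGraph.fromRel fun a b => a ∈ W ∧ f a = b
  have hmatch : ∀ a ∈ W, P.Adj a (f a) := fun a ha =>
    (SimpleGraph.fromRel_adj _ _ _).2 ⟨(hf a ha).2.ne, Or.inl ⟨ha, rfl⟩⟩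
  have hcases : ∀ a b, P.Adj a b → (a ∈ W ∧ b = f a) ∨ (b ∈ W ∧ a = f b) := fun a b hab =>
    ((SimpleGraph.fromRel_adj _ _ _).1 hab).2.imp (And.imp_right Eq.symm) (And.imp_right Eq.symm)
  refine ⟨P, separator G T E ∩ T ∪ W.image f, fun a b hab => ?_, fun a b hab => ?_,
    fun a b hab haT => ?_, ?_, ?_, fun y hy => ?_, ?_⟩
  · rcases hcases a b hab with ⟨ha, rfl⟩ | ⟨hb, rfl⟩
    exacts [(hf a ha).2, (hf b hb).2.symm]
  · rcases hcases a b hab with ⟨ha, rfl⟩ | ⟨hb, rfl⟩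
    exacts [mem_union_right _ (mem_sdiff.1 ha).1, mem_union_left _ (mem_inter.1 (hf b hb).1).1]
  · rcases hcases a b hab with ⟨ha, rfl⟩ | ⟨hb, rfl⟩
    exacts [absurd haT (mem_sdiff.1 ha).2, mem_union_right _ (mem_image_of_mem f hb)]
  · refine union_subset inter_subset_right (image_subset_iff.2 fun y hy => ?_)
    exact (mem_inter.1 (hf y hy).1).2
  · have := card_union_le (separator G T E ∩ T) (W.image f)
    have := card_image_le (s := W) (f := f)
    have := hW ▸ card_inter_add_card_sdiff (separator G T E) T
    omega
  · by_cases hyT : y ∈ T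
    · exact ⟨y, mem_union_left _ (mem_inter.2 ⟨hy, hyT⟩), SimpleGraph.Reachable.refl y⟩
    · have hyW : y ∈ W := mem_sdiff.2 ⟨hy, hyT⟩
      exact ⟨f y, mem_union_right _ (mem_image_of_mem f hyW), (hmatch y hyW).reachable⟩
  · let r : V → V := Function.extend (Set.domRestrict ↑W f) Subtype.val id
    have hr : ∀ y ∈ separator G T E, r y = y := fun y hy =>
      Function.extend_apply' _ _ y fun ⟨z, hz⟩ =>
        (mem_separator.1 hy).1 (hz ▸ (mem_inter.1 (hf z z.2).1).1)
    have hrf : ∀ y ∈ W, r (f y) = r y := fun y hy =>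
      (hinj.injective.extend_apply Subtype.val id ⟨y, hy⟩).trans (hr y (mem_sdiff.1 hy).1).symm
    refine ⟨r, hr, fun a b hab => ?_⟩
    rcases hcases a b hab with ⟨ha, rfl⟩ | ⟨hb, rfl⟩
    exacts [(hrf a ha).symm, hrf b hb]

theorem separator_deleteEdges_of_mem {a b : V} (ha : a ∈ E) (hb : b ∈ E) :
    separator (G.deleteEdges {s(a, b)}) T E = separator G T E := by
  rw [separator, separator, boundary_deleteEdges_of_mem ha hb]

theorem card_separator_le_card_separator_deleteEdges_add_one (G : SimpleGraph V) (T E : Finset V)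
    (a b : V) : #(separator G T E) ≤ #(separator (G.deleteEdges {s(a, b)}) T E) + 1 := by
  obtain ⟨z, hz⟩ := exists_boundary_subset_insert_deleteEdges G E a b
  refine (card_le_card ?_).trans (card_insert_le z _)
  rw [separator, separator, ← insert_union]
  exact union_subset_union_left hz

/- If some proper part of `E` determines a separator of the same size, a linkage for this part is
extended by one that avoids it. Otherwise, the size of the other separators leaves room to delete an
edge within `E`, and when there are none left Hall's theorem applies. -/
theorem exists_linkage_of_separator_minimal (G : SimpleGraph V) (E T : Finset V)
    (hmin : ∀ E' ⊆ E, #(separator G T E) ≤ #(separator G T E')) :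
    ∃ P S, Linkage G P E T (separator G T E) S := by
  induction hn : #E + G.edgeSet.ncard using Nat.strong_induction_on generalizing G E T with
  | _ n ih =>
  subst hn
  by_cases htight : ∃ E' ⊆ E, E'.Nonempty ∧ E' ≠ E ∧ #(separator G T E') ≤ #(separator G T E)
  · obtain ⟨E', hE', hne, hne', hcard⟩ := htight
    have hlt : #E' < #E := card_lt_card (hE'.ssubset_of_ne hne')
    have hlt' : #(E \ E') < #E := card_lt_card (sdiff_ssubset hE' hne)
    have hedges : (avoid G E').edgeSet.ncard ≤ G.edgeSet.ncard :=
      Set.ncard_le_ncard (SimpleGraph.edgeSet_subset_edgeSet.2 (avoid_le G E'))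
    have hsep : ∀ F ⊆ E \ E',
        separator (avoid G E') (separator G T E') F = separator G T (E' ∪ F) := fun F hF =>
      separator_avoid (disjoint_of_subset_right hF disjoint_sdiff)
    have hsepE : separator (avoid G E') (separator G T E') (E \ E') = separator G T E := by
      rw [hsep _ subset_rfl, union_sdiff_of_subset hE']
    obtain ⟨P₂, S₂, h₂⟩ := ih _ (by omega) G E' T
      (fun F hF => hcard.trans (hmin F (hF.trans hE'))) rfl
    obtain ⟨P₁, S₁, h₁⟩ := ih _ (by omega) (avoid G E') (E \ E') (separator G T E')
      (fun F hF => by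
        rw [hsepE, hsep F hF]
        exact hmin _ (union_subset hE' (hF.trans sdiff_subset))) rfl
    exact ⟨_, _, (hsepE ▸ h₁).comp hE' hcard h₂⟩
  push Not at htight
  by_cases hedge : ∃ a ∈ E, ∃ b ∈ E, G.Adj a b
  · obtain ⟨a, ha, b, hb, hab⟩ := hedge
    have hsepE := separator_deleteEdges_of_mem (G := G) (T := T) ha hb
    obtain ⟨P, S, h⟩ := ih _ (Nat.add_lt_add_left (ncard_edgeSet_deleteEdges_lt hab) _)
      (G.deleteEdges {s(a, b)}) E T (fun F hF => by
        rw [hsepE]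
        have hdel := card_separator_le_card_separator_deleteEdges_add_one G T F a b
        rcases F.eq_empty_or_nonempty with rfl | hne
        · simpa [separator, boundary_empty] using hmin ∅ hF
        by_cases hFE : F = E
        · rw [hFE, hsepE]
        · have := htight F hF hne hFE
          omega) rfl
    exact ⟨P, S, (hsepE ▸ h).mono_left (G.deleteEdges_le _)⟩
  · push Not at hedge
    obtain ⟨f, hinj, hf⟩ := exists_matching_of_separator_minimal hmin hedge
    exact exists_linkage_of_matching hinj hf

theorem linked_of_separator_minimal {G' : SimpleGraph V} (hle : G' ≤ G) {Q U : Finset V}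
    (hmin : ∀ E' ⊆ E, #(separator G' T E) ≤ #(separator G' T E'))
    (hlinked : ∀ S ⊆ T, #S ≤ #(separator G' T E) → Linked G Q S)
    (hQsep : ∀ a ∈ Q, a ∈ separator G' T E → a ∈ T)
    (hQadj : ∀ a ∈ Q, ∀ b, G'.Adj a b → a ∈ T)
    (hU : E ∪ separator G' T E ⊆ U) (hQ : Q ⊆ U) :
    Linked G U (separator G' T E) := by
  obtain ⟨P, S, h⟩ := exists_linkage_of_separator_minimal G' E T hmin
  obtain ⟨r, hr, hP⟩ := h.retraction
  intro c
  obtain ⟨l, hl, hreach⟩ := hlinked S h.subset h.card_le (c ∘ r)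
  let l' : V → ℕ := fun a => if a ∈ Q then l a else c (r a)
  have hl' : ∀ a, (a ∈ Q → a ∈ S) → l' a = c (r a) := fun a ha =>
    ite_eq_right_iff.2 fun haQ => hl a (ha haQ)
  have hPl : P ≤ monochromatic G U l' := by
    intro a b hab
    refine ⟨hle (h.le hab), hU (h.mem_of_adj a b hab), hU (h.mem_of_adj b a hab.symm), ?_⟩
    rw [hl' a fun haQ => h.mem_target a b hab (hQadj a haQ b (h.le hab)),
      hl' b fun hbQ => h.mem_target b a hab.symm (hQadj b hbQ a (h.le hab.symm)), hP a b hab]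
  have hQl : monochromatic G Q l ≤ monochromatic G U l' :=
    monochromatic_mono le_rfl hQ fun a ha => if_pos ha
  refine ⟨l', fun y hy => ?_, fun x hx y hy hxy => ?_⟩
  · rw [hl' y fun hyQ => h.mem hy (hQsep y hyQ hy), hr y hy]
  · obtain ⟨x', hx', hxx⟩ := h.reachable x hx
    obtain ⟨y', hy', hyy⟩ := h.reachable y hy
    have hxy' : (c ∘ r) x' = (c ∘ r) y' := by
      simp only [Function.comp, ← eq_of_reachable hP hxx, ← eq_of_reachable hP hyy, hr x hx,
        hr y hy, hxy]
    exact (hxx.mono hPl).trans (((hreach x' hx' y' hy' hxy').mono hQl).trans (hyy.mono hPl).symm)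

end Menger

/-! ### Massed pairs -/

section Massed

variable {V : Type u} [Fintype V] {G : SimpleGraph V} {D : Finset V}

/-- `D` links its boundary: the boundary of `D` is linked in the union of `D` and its boundary. -/
def BoundaryLinked (G : SimpleGraph V) (D : Finset V) : Prop :=
  Linked G (D ∪ boundary G D) (boundary G D)

/-- The ordered pairs of adjacent vertices that meet `D`; an edge that meets `D` gives two of
them. -/
def pairsMeeting (G : SimpleGraph V) (D : Finset V) : Finset (V × V) :=
  {p | G.Adj p.1 p.2 ∧ (p.1 ∈ D ∨ p.2 ∈ D)}

theorem mem_pairsMeeting {p : V × V} :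
    p ∈ pairsMeeting G D ↔ G.Adj p.1 p.2 ∧ (p.1 ∈ D ∨ p.2 ∈ D) :=
  mem_filter_univ p

/-- Twice the number of edges that meet `D`. -/
def touch (G : SimpleGraph V) (D : Finset V) : ℕ := #(pairsMeeting G D)

/-- The pair `(R, X)` is massed in `G`: the boundary of `R` lies in `X` and many edges meet `R`,
whereas few edges meet a part of `R` with fewer than `|X|` neighbours. This is the notion of Thomas
and Wollan (*An improved linear edge bound for graph linkages*), with edges counted twice. -/
structure Massed (Λ : ℕ) (G : SimpleGraph V) (R X : Finset V) : Prop where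
  disjoint : Disjoint R X
  boundary_subset : boundary G R ⊆ X
  lt_touch : Λ * #R < touch G R
  touch_le : ∀ D ⊆ R, #(boundary G D) < #X → touch G D ≤ Λ * #D

theorem boundary_subset_union {E : Finset V} (h : D ⊆ E) : boundary G D ⊆ E ∪ boundary G E := by
  intro a ha
  obtain ⟨-, d, hd, hda⟩ := mem_boundary.1 ha
  exact mem_union.2 (or_iff_not_imp_left.2 fun haE => mem_boundary.2 ⟨haE, d, h hd, hda⟩)

theorem separator_empty (G : SimpleGraph V) (D : Finset V) : separator G ∅ D = boundary G D := by
  rw [separator, empty_sdiff, union_empty]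

theorem separator_avoid_boundary {E : Finset V} (h : Disjoint D E) :
    separator (avoid G D) (boundary G D) E = boundary G (D ∪ E) := by
  rw [← separator_empty, separator_avoid h, separator_empty]

theorem BoundaryLinked.extend {E : Finset V} (hD : BoundaryLinked G D) (hDE : D ⊆ E)
    (hmin : ∀ E', D ⊆ E' → E' ⊆ E → #(boundary G E) ≤ #(boundary G E')) : BoundaryLinked G E := by
  have hE : separator (avoid G D) (boundary G D) (E \ D) = boundary G E := by
    rw [separator_avoid_boundary disjoint_sdiff, union_sdiff_of_subset hDE]
  rw [BoundaryLinked, ← hE]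
  refine linked_of_separator_minimal (avoid_le G D) (Q := D ∪ boundary G D) (fun E' hE' => ?_)
    (fun S hS _ => Linked.subset hD hS) (fun a ha hasep => ?_) (fun a ha b hab => ?_)
    (union_subset_union sdiff_subset subset_rfl) ?_
  · rw [hE, separator_avoid_boundary (disjoint_of_subset_right hE' disjoint_sdiff)]
    exact hmin _ subset_union_left (union_subset hDE (hE'.trans sdiff_subset))
  · rw [hE] at hasep
    exact (mem_union.1 ha).resolve_left fun haD => (mem_boundary.1 hasep).1 (hDE haD)
  · exact (mem_union.1 ha).resolve_left hab.2.1
  · rw [hE]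
    exact union_subset (hDE.trans subset_union_left) (boundary_subset_union hDE)

theorem Massed.boundary_eq {Λ : ℕ} {R X : Finset V} (hM : Massed Λ G R X) : boundary G R = X := by
  refine eq_of_subset_of_card_le hM.boundary_subset ?_
  by_contra! h
  exact (hM.touch_le R subset_rfl h).not_gt hM.lt_touch

theorem exists_massed_of_lt_touch {Λ : ℕ} (h : Λ * #D < touch G D) :
    ∃ D' ⊆ D, #(boundary G D') ≤ #(boundary G D) ∧ Massed Λ G D' (boundary G D') := by
  obtain ⟨D', hD', hmin⟩ := exists_min_image
    {D' ∈ D.powerset | #(boundary G D') ≤ #(boundary G D) ∧ Λ * #D' < touch G D'} card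
    ⟨D, by simp [h]⟩
  simp only [mem_filter, mem_powerset] at hD' hmin
  obtain ⟨hD'D, hcard, hlt⟩ := hD'
  refine ⟨D', hD'D, hcard, disjoint_boundary G D', subset_rfl, hlt, fun F hF hFcard => ?_⟩
  by_contra! hcon
  have hle := hmin F ⟨hF.trans hD'D, hFcard.le.trans hcard, hcon⟩
  exact hFcard.ne (congrArg (fun E => #(boundary G E)) (eq_of_subset_of_card_le hF hle))

end Massed

/-! ### Torsos -/

section Torso

variable {V : Type u} [Fintype V] {G : SimpleGraph V} {D D' : Finset V}

/-- The torso of `G` at the complement of `D`: the edges that meet `D` are replaced by a clique on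
the boundary of `D`. -/
def torso (G : SimpleGraph V) (D : Finset V) : SimpleGraph V where
  Adj a b := a ≠ b ∧ ((G.Adj a b ∧ a ∉ D ∧ b ∉ D) ∨ (a ∈ boundary G D ∧ b ∈ boundary G D))
  symm := ⟨fun _ _ h => ⟨h.1.symm, h.2.imp (fun h => ⟨h.1.symm, h.2.2, h.2.1⟩) And.symm⟩⟩
  loopless := ⟨fun _ h => h.1 rfl⟩

theorem notMem_of_torso_adj {a b : V} (h : (torso G D).Adj a b) : a ∉ D :=
  h.2.elim (fun h => h.2.1) fun h => (mem_boundary.1 h.1).1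

theorem boundary_torso_sdiff_subset {R : Finset V} (h : D ⊆ R) :
    boundary (torso G D) (R \ D) ⊆ boundary G R := by
  intro v hv
  obtain ⟨hvRD, d, hd, hdv⟩ := mem_boundary.1 hv
  have hvR : v ∉ R := fun hvR => hvRD (mem_sdiff.2 ⟨hvR, notMem_of_torso_adj hdv.symm⟩)
  rcases hdv.2 with ⟨hdv, -, -⟩ | ⟨-, hvD⟩
  · exact mem_boundary.2 ⟨hvR, d, (mem_sdiff.1 hd).1, hdv⟩
  · obtain ⟨-, e, he, hev⟩ := mem_boundary.1 hvD
    exact mem_boundary.2 ⟨hvR, e, h he, hev⟩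

theorem touch_le_touch_add_touch_torso_sdiff (G : SimpleGraph V) (D R : Finset V) :
    touch G R ≤ touch G D + touch (torso G D) (R \ D) := by
  refine (card_le_card fun p hp => ?_).trans (card_union_le _ _)
  simp only [mem_union, mem_pairsMeeting, mem_sdiff] at hp ⊢
  by_cases hp1 : p.1 ∈ D
  · exact Or.inl ⟨hp.1, Or.inl hp1⟩
  by_cases hp2 : p.2 ∈ D
  · exact Or.inl ⟨hp.1, Or.inr hp2⟩
  · exact Or.inr ⟨⟨hp.1.ne, Or.inl ⟨hp.1, hp1, hp2⟩⟩, by tauto⟩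

theorem boundary_subset_union_boundary_torso (hmeet : ¬ Disjoint D' (boundary G D)) :
    boundary G D ⊆ D' ∪ boundary (torso G D) D' := by
  obtain ⟨x, hxD', hxD⟩ := not_disjoint_iff.1 hmeet
  intro y hy
  refine mem_union.2 (or_iff_not_imp_left.2 fun hyD' => mem_boundary.2 ⟨hyD', x, hxD', ?_⟩)
  exact ⟨fun h => hyD' (h ▸ hxD'), Or.inr ⟨hxD, hy⟩⟩

theorem disjoint_union_boundary_torso (hdisj : Disjoint D D') :
    Disjoint D (D' ∪ boundary (torso G D) D') := by
  refine disjoint_union_right.2 ⟨hdisj, disjoint_right.2 fun v hv => ?_⟩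
  obtain ⟨-, d, -, hdv⟩ := mem_boundary.1 hv
  exact notMem_of_torso_adj hdv.symm

theorem boundary_union_eq_boundary_torso (hdisj : Disjoint D D')
    (hmeet : ¬ Disjoint D' (boundary G D)) :
    boundary G (D ∪ D') = boundary (torso G D) D' := by
  ext v
  constructor
  · intro hv
    obtain ⟨hvDD', d, hd, hdv⟩ := mem_boundary.1 hv
    rw [mem_union, not_or] at hvDD'
    rcases mem_union.1 hd with hd | hd
    · have hvD : v ∈ boundary G D := mem_boundary.2 ⟨hvDD'.1, d, hd, hdv⟩
      exact (mem_union.1 (boundary_subset_union_boundary_torso hmeet hvD)).resolve_left hvDD'.2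
    · exact mem_boundary.2
        ⟨hvDD'.2, d, hd, hdv.ne, Or.inl ⟨hdv, disjoint_right.1 hdisj hd, hvDD'.1⟩⟩
  · intro hv
    obtain ⟨hvD', d, hd, hdv⟩ := mem_boundary.1 hv
    have hvDD' : v ∉ D ∪ D' := by
      rw [mem_union, not_or]
      exact ⟨notMem_of_torso_adj hdv.symm, hvD'⟩
    rcases hdv.2 with ⟨hdv, -, -⟩ | ⟨-, hvD⟩
    · exact mem_boundary.2 ⟨hvDD', d, mem_union_right _ hd, hdv⟩
    · obtain ⟨-, e, he, hev⟩ := mem_boundary.1 hvD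
      exact mem_boundary.2 ⟨hvDD', e, mem_union_left _ he, hev⟩

theorem boundary_subset_boundary_torso (hdisj : Disjoint D D')
    (hmiss : Disjoint D' (boundary G D)) : boundary G D' ⊆ boundary (torso G D) D' := by
  intro v hv
  obtain ⟨hvD', d, hd, hdv⟩ := mem_boundary.1 hv
  have hdD := disjoint_right.1 hdisj hd
  refine mem_boundary.2 ⟨hvD', d, hd, hdv.ne, Or.inl ⟨hdv, hdD, fun hvD => ?_⟩⟩
  exact disjoint_left.1 hmiss hd (mem_boundary.2 ⟨hdD, v, hvD, hdv.symm⟩)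

theorem touch_torso_le_touch (hmiss : Disjoint D' (boundary G D)) :
    touch (torso G D) D' ≤ touch G D' := by
  refine card_le_card fun p hp => ?_
  rw [mem_pairsMeeting] at hp ⊢
  obtain ⟨⟨-, h | h⟩, hp⟩ := hp
  · exact ⟨h.1, hp⟩
  · rcases hp with hp | hp
    exacts [absurd h.1 (disjoint_left.1 hmiss hp), absurd h.2 (disjoint_left.1 hmiss hp)]

theorem BoundaryLinked.linked_of_torso {U Y : Finset V} (hD : BoundaryLinked G D)
    (hU : Linked (torso G D) U Y) (hsub : boundary G D ⊆ U) (hdisj : Disjoint D U) (hYU : Y ⊆ U) :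
    Linked G (D ∪ U) Y := by
  intro c
  obtain ⟨l', hl', hreach'⟩ := hU c
  obtain ⟨l₂, hl₂, hreach₂⟩ := hD l'
  let l : V → ℕ := fun a => if a ∈ D then l₂ a else l' a
  have l_of_notMem : ∀ a ∉ D, l a = l' a := fun a ha => if_neg ha
  have l_of_mem : ∀ a ∈ D ∪ boundary G D, l a = l₂ a := by
    intro a ha
    by_cases haD : a ∈ D
    · exact if_pos haD
    · rw [l_of_notMem a haD, hl₂ a ((mem_union.1 ha).resolve_left haD)]
  have hle : monochromatic G (D ∪ boundary G D) l₂ ≤ monochromatic G (D ∪ U) l :=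
    monochromatic_mono le_rfl (union_subset_union subset_rfl hsub) l_of_mem
  refine ⟨l, fun y hy => ?_, fun x hx y hy hxy => ?_⟩
  · rw [l_of_notMem y (disjoint_right.1 hdisj (hYU hy)), hl' y hy]
  · refine reachable_of_forall_adj (fun a b hab => ?_) (hreach' x hx y hy hxy)
    obtain ⟨⟨-, hab | hab⟩, ha, hb, hlab⟩ := hab
    · refine SimpleGraph.Adj.reachable ⟨hab.1, mem_union_right _ ha, mem_union_right _ hb, ?_⟩
      rw [l_of_notMem a hab.2.1, l_of_notMem b hab.2.2, hlab]
    · exact (hreach₂ a hab.1 b hab.2 hlab).mono hle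

end Torso

section MassedTorso

/-- The induction hypothesis in the proof that massed pairs are linked: every massed pair `(R, X)`
in a graph on `V` with `|R| < n` and `|X| ≤ m` is linked. -/
def MassedLinkedBelow (V : Type u) [Fintype V] (Λ m n : ℕ) : Prop :=
  ∀ (G : SimpleGraph V) (R X : Finset V),
    #R < n → #X ≤ m → Massed Λ G R X → Linked G (R ∪ X) X

variable {V : Type u} [Fintype V] {G : SimpleGraph V} {D R X : Finset V} {Λ m : ℕ}

theorem Massed.touch_torso_le (hM : Massed Λ G R X) (ih : MassedLinkedBelow V Λ m #R)
    (hX : #X ≤ m) (hDR : D ⊆ R) (hD : D.Nonempty) (hL : BoundaryLinked G D)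
    (hmax : ∀ E ⊆ R, D ⊂ E → #(boundary G E) ≤ #X → ¬ BoundaryLinked G E) {F : Finset V}
    (hF : F ⊆ R \ D) (hFX : #(boundary (torso G D) F) < #X) : touch (torso G D) F ≤ Λ * #F := by
  by_contra! hcon
  obtain ⟨D', hD'F, hcard, hM'⟩ := exists_massed_of_lt_touch hcon
  have hD'R : D' ⊆ R \ D := hD'F.trans hF
  have hdisj : Disjoint D D' := disjoint_of_subset_right hD'R disjoint_sdiff
  by_cases hmeet : Disjoint D' (boundary G D)
  · have hbound := hM.touch_le D' (hD'R.trans sdiff_subset)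
      ((card_le_card (boundary_subset_boundary_torso hdisj hmeet)).trans_lt (hcard.trans_lt hFX))
    exact (hbound.trans_lt hM'.lt_touch).not_ge (touch_torso_le_touch hmeet)
  · have hlt : #D' < #R := (card_le_card hD'R).trans_lt (card_lt_card (sdiff_ssubset hDR hD))
    have hglue := hL.linked_of_torso (ih _ _ _ hlt ((hcard.trans hFX.le).trans hX) hM')
      (boundary_subset_union_boundary_torso hmeet) (disjoint_union_boundary_torso hdisj)
      subset_union_right
    rw [← union_assoc, ← boundary_union_eq_boundary_torso hdisj hmeet] at hglue
    refine hmax (D ∪ D') (union_subset hDR (hD'R.trans sdiff_subset)) ?_ ?_ hglue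
    · obtain ⟨x, hxD', hxD⟩ := not_disjoint_iff.1 hmeet
      refine subset_union_left.ssubset_of_ne fun h => ?_
      exact (mem_boundary.1 hxD).1 (h ▸ mem_union_right D hxD')
    · rw [boundary_union_eq_boundary_torso hdisj hmeet]
      exact (hcard.trans_lt hFX).le

theorem Massed.torso (hM : Massed Λ G R X) (ih : MassedLinkedBelow V Λ m #R)
    (hX : #X ≤ m) (hDR : D ⊆ R) (hD : D.Nonempty) (hDX : #(boundary G D) < #X)
    (hL : BoundaryLinked G D)
    (hmax : ∀ E ⊆ R, D ⊂ E → #(boundary G E) ≤ #X → ¬ BoundaryLinked G E) :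
    Massed Λ (torso G D) (R \ D) X where
  disjoint := disjoint_of_subset_left sdiff_subset hM.disjoint
  boundary_subset := (boundary_torso_sdiff_subset hDR).trans hM.boundary_subset
  lt_touch := by
    have htouch := touch_le_touch_add_touch_torso_sdiff G D R
    have hDle := hM.touch_le D hDR hDX
    have hlt := hM.lt_touch
    rw [← card_sdiff_add_card_eq_card hDR, mul_add] at hlt
    omega
  touch_le _ := hM.touch_torso_le ih hX hDR hD hL hmax

theorem Massed.linked_of_boundaryLinked (hM : Massed Λ G R X) (ih : MassedLinkedBelow V Λ m #R)
    (hX : #X ≤ m) (hDR : D ⊆ R) (hD : D.Nonempty) (hDX : #(boundary G D) ≤ #X)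
    (hL : BoundaryLinked G D) : Linked G (R ∪ X) X := by
  obtain ⟨A, hDA, ⟨hAR, hAX, hAL⟩, hAmax⟩ :=
    (Set.toFinite {E | E ⊆ R ∧ #(boundary G E) ≤ #X ∧ BoundaryLinked G E}).exists_le_maximal
      ⟨hDR, hDX, hL⟩
  have hmax : ∀ E ⊆ R, A ⊂ E → #(boundary G E) ≤ #X → ¬ BoundaryLinked G E :=
    fun E hER hAE hEX hEL => hAE.not_subset (hAmax ⟨hER, hEX, hEL⟩ hAE.subset)
  obtain ⟨E, hE, hEmin⟩ := exists_min_image {E ∈ R.powerset | A ⊆ E} (fun E => #(boundary G E))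
    ⟨A, by simp [hAR]⟩
  simp only [mem_filter, mem_powerset] at hE hEmin
  obtain ⟨hER, hAE⟩ := hE
  have hEL : BoundaryLinked G E :=
    hAL.extend hAE fun E' hAE' hE'E => hEmin E' ⟨hE'E.trans hER, hAE'⟩
  have hEA : A = E := by
    by_contra hne
    exact hmax E hER (hAE.ssubset_of_ne hne) ((hEmin A ⟨hAR, subset_rfl⟩).trans hAX) hEL
  subst hEA
  rcases hAX.lt_or_eq with hlt | heq
  · have hAne : A.Nonempty := hD.mono hDA
    have hT := ih _ _ _ (card_lt_card (sdiff_ssubset hAR hAne)) hX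
      (hM.torso ih hX hAR hAne hlt hAL hmax)
    have hsub : boundary G A ⊆ R \ A ∪ X := fun v hv => by
      have := boundary_subset_union hAR hv
      rw [hM.boundary_eq] at this
      simp only [mem_union, mem_sdiff] at this ⊢
      exact this.imp_left fun hvR => ⟨hvR, (mem_boundary.1 hv).1⟩
    have hglue := hAL.linked_of_torso hT hsub (disjoint_union_right.2
      ⟨disjoint_sdiff, disjoint_of_subset_left hAR hM.disjoint⟩) subset_union_right
    rwa [← union_assoc, union_sdiff_of_subset hAR] at hglue
  · have hRL := hAL.extend hAR fun E' hAE' hE'R => by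
      rw [hM.boundary_eq, ← heq]
      exact hEmin E' ⟨hE'R, hAE'⟩
    rwa [BoundaryLinked, hM.boundary_eq] at hRL

end MassedTorso

section Contract

variable {V : Type u} {G : SimpleGraph V} {u v : V}

/-- The contraction of the edge `uv` to `u`; the vertex `v` is kept as an isolated vertex. -/
def contract (G : SimpleGraph V) (u v : V) : SimpleGraph V where
  Adj a b := a ≠ b ∧ a ≠ v ∧ b ≠ v ∧ (G.Adj a b ∨ (a = u ∧ G.Adj v b) ∨ (b = u ∧ G.Adj v a))
  symm := ⟨fun _ _ h => ⟨h.1.symm, h.2.2.1, h.2.1, h.2.2.2.imp SimpleGraph.Adj.symm Or.symm⟩⟩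
  loopless := ⟨fun _ h => h.1 rfl⟩

theorem Linked.of_contract {U Y : Finset V} (huv : G.Adj u v) (hu : u ∈ U) (hvY : v ∉ Y)
    (hL : Linked (contract G u v) U Y) : Linked G (insert v U) Y := by
  intro c
  obtain ⟨l', hl', hreach⟩ := hL c
  let l : V → ℕ := fun a => if a = v then l' u else l' a
  have l_of_ne : ∀ a, a ≠ v → l a = l' a := fun a ha => if_neg ha
  have l_v : l v = l' u := if_pos rfl
  have hv : v ∈ insert v U := mem_insert_self _ _
  have huv' : (monochromatic G (insert v U) l).Adj u v :=
    ⟨huv, mem_insert_of_mem hu, hv, by rw [l_of_ne u huv.ne, l_v]⟩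
  have hvb : ∀ b ∈ U, b ≠ v → G.Adj v b → l' u = l' b →
      (monochromatic G (insert v U) l).Reachable u b := fun b hb hbv hadj hub =>
    huv'.reachable.trans (SimpleGraph.Adj.reachable
      ⟨hadj, hv, mem_insert_of_mem hb, by rw [l_v, l_of_ne b hbv, hub]⟩)
  refine ⟨l, fun y hy => ?_, fun x hx y hy hxy => ?_⟩
  · rw [l_of_ne y (fun h => hvY (h ▸ hy)), hl' y hy]
  · refine reachable_of_forall_adj (fun a b hab => ?_) (hreach x hx y hy hxy)
    obtain ⟨⟨-, hav, hbv, h⟩, ha, hb, hlab⟩ := hab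
    rcases h with h | ⟨rfl, h⟩ | ⟨rfl, h⟩
    · exact SimpleGraph.Adj.reachable ⟨h, mem_insert_of_mem ha, mem_insert_of_mem hb,
        by rw [l_of_ne a hav, l_of_ne b hbv, hlab]⟩
    · exact hvb b hb hbv h hlab
    · exact (hvb a ha hav h hlab.symm).symm

end Contract

/-! ### Robustly connected sets -/

section Robust

variable {V : Type u} {G : SimpleGraph V}

/-- The set `U` is robust: after the deletion of any `K` vertices, any two vertices left in `U` are
joined by a walk of length at most five in what is left of `U`. -/
def Robust (G : SimpleGraph V) (K : ℕ) (U : Finset V) : Prop :=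
  ∀ Z : Finset V, #Z ≤ K → ∀ x ∈ U \ Z, ∀ y ∈ U \ Z,
    ∃ p : G.Walk x y, p.length ≤ 5 ∧ ∀ v ∈ p.support, v ∈ U \ Z

theorem exists_labelling_of_walk {W : Finset V} {l : V → ℕ} {x y : V} (p : G.Walk x y) {k : ℕ}
    (hp : ∀ v ∈ p.support, v ∈ W → l v = k) :
    ∃ l' : V → ℕ, (∀ v ∈ W, l' v = l v) ∧
      (monochromatic G (W ∪ p.support.toFinset) l').Reachable x y := by
  refine ⟨fun v => if v ∈ p.support then k else l v, fun v hv => ?_, ?_⟩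
  · exact ite_eq_right_iff.2 fun hvp => (hp v hvp hv).symm
  · exact reachable_monochromatic_of_walk p
      (fun v hv => mem_union_right _ (List.mem_toFinset.2 hv)) fun v hv => if_pos hv

/- The paths are chosen one by one, each avoiding the at most `7 * #S` vertices labelled before. -/
theorem Robust.exists_labelling {K : ℕ} {U S A : Finset V} (hU : Robust G K U) (hS : S ⊆ U)
    (hK : 7 * #S ≤ K) {c : V → ℕ} {r : V → V} (hr : ∀ x ∈ S, r x ∈ S ∧ c (r x) = c x)
    (hA : A ⊆ S) :
    ∃ (l : V → ℕ) (W : Finset V), S ⊆ W ∧ W ⊆ U ∧ #W ≤ #S + 6 * #A ∧ (∀ y ∈ S, l y = c y) ∧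
      ∀ x ∈ A, (monochromatic G W l).Reachable x (r x) := by
  induction A using Finset.induction_on with
  | empty => exact ⟨c, S, subset_rfl, hS, by simp, fun _ _ => rfl, by simp⟩
  | insert a A haA ih =>
    obtain ⟨l, W, hSW, hWU, hW, hl, hreach⟩ := ih ((subset_insert _ _).trans hA)
    have ha : a ∈ S := hA (mem_insert_self _ _)
    have hAS : #A + 1 ≤ #S := card_insert_of_notMem haA ▸ card_le_card hA
    obtain ⟨p, hp, hpU⟩ := hU (W \ {a, r a}) ((card_le_card sdiff_subset).trans (by omega))
      a (by simp [hS ha]) (r a) (by simp [hS (hr a ha).1])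
    have hpW : ∀ v ∈ p.support, v ∈ W → l v = c a := fun v hv hvW => by
      have hva : v = a ∨ v = r a := by
        by_contra hne
        exact (mem_sdiff.1 (hpU v hv)).2 (mem_sdiff.2 ⟨hvW, by simpa using hne⟩)
      rcases hva with rfl | rfl
      · exact hl v ha
      · rw [hl _ (hr a ha).1, (hr a ha).2]
    obtain ⟨l', hl', hreach'⟩ := exists_labelling_of_walk p hpW
    refine ⟨l', W ∪ p.support.toFinset, hSW.trans subset_union_left,
      union_subset hWU fun v hv => ?_, ?_, fun y hy => (hl' y (hSW hy)).trans (hl y hy),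
      fun x hx => ?_⟩
    · exact (mem_sdiff.1 (hpU v (List.mem_toFinset.1 hv))).1
    · have hsupport := List.toFinset_card_le p.support
      rw [p.length_support] at hsupport
      rw [card_insert_of_notMem haA]
      have := card_union_le W p.support.toFinset
      omega
    · rcases mem_insert.1 hx with rfl | hx
      · exact hreach'
      · exact (hreach x hx).mono (monochromatic_mono le_rfl subset_union_left hl')

theorem Robust.linked {K : ℕ} {U S : Finset V} (hU : Robust G K U) (hS : S ⊆ U)
    (hK : 7 * #S ≤ K) : Linked G U S := by
  intro c
  rcases S.eq_empty_or_nonempty with rfl | ⟨s, -⟩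
  · exact ⟨c, by simp⟩
  have : Nonempty V := ⟨s⟩
  let r : V → V := fun x => Function.invFunOn c ↑S (c x)
  have hr : ∀ x ∈ S, r x ∈ S ∧ c (r x) = c x := fun x hx => Function.invFunOn_pos ⟨x, hx, rfl⟩
  obtain ⟨l, W, -, hWU, -, hl, hreach⟩ := hU.exists_labelling hS hK hr subset_rfl
  refine ⟨l, hl, fun x hx y hy hxy => ?_⟩
  have hrxy : r x = r y := congrArg (Function.invFunOn c ↑S) hxy
  exact ((hreach x hx).trans (hrxy ▸ (hreach y hy).symm)).mono
    (monochromatic_mono le_rfl hWU fun _ _ => rfl)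

theorem robust_of_card_lt {K d : ℕ} {U : Finset V} (hd : ∀ x ∈ U, d ≤ #{y ∈ U | G.Adj x y})
    (h : #U + K < 2 * d) : Robust G K U := by
  intro Z hZ x hx y hy
  have hcommon : #Z < #({w ∈ U | G.Adj x w} ∩ {w ∈ U | G.Adj y w}) := by
    have hunion : #({w ∈ U | G.Adj x w} ∪ {w ∈ U | G.Adj y w}) ≤ #U :=
      card_le_card (union_subset (filter_subset _ _) (filter_subset _ _))
    have := card_union_add_card_inter {w ∈ U | G.Adj x w} {w ∈ U | G.Adj y w}
    have := hd x (mem_sdiff.1 hx).1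
    have := hd y (mem_sdiff.1 hy).1
    omega
  obtain ⟨w, hw, hwZ⟩ := exists_mem_notMem_of_card_lt_card hcommon
  simp only [mem_inter, mem_filter] at hw
  obtain ⟨⟨hwU, hxw⟩, -, hyw⟩ := hw
  refine ⟨.cons hxw (.cons hyw.symm .nil), by simp, fun v hv => ?_⟩
  simp only [SimpleGraph.Walk.support_cons, SimpleGraph.Walk.support_nil, List.mem_cons,
    List.not_mem_nil, or_false] at hv
  rcases hv with rfl | rfl | rfl
  exacts [hx, mem_sdiff.2 ⟨hwU, hwZ⟩, hy]

/- The closed neighbourhoods of the vertices numbered 0, 3 and 6 on a shortest path of length at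
least six would be disjoint. -/
theorem dist_le_five_of_card_lt {W : Type v} [Fintype W] {F : SimpleGraph W} {d : ℕ}
    (hd : ∀ x, d ≤ F.degree x) (hW : Fintype.card W < 3 * (d + 1)) {x y : W}
    (hxy : F.Reachable x y) : F.dist x y ≤ 5 := by
  obtain ⟨p, hp⟩ := hxy.exists_walk_length_eq_dist
  by_contra! hlen
  rw [← hp] at hlen
  let B : ℕ → Finset W := fun i => insert (p.getVert i) (F.neighborFinset (p.getVert i))
  have hBcard : ∀ i, d + 1 ≤ #(B i) := fun i => by
    rw [card_insert_of_notMem (by simp), F.card_neighborFinset_eq_degree]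
    exact Nat.succ_le_succ (hd _)
  have hBwalk : ∀ i, ∀ w ∈ B i, ∃ q : F.Walk (p.getVert i) w, q.length ≤ 1 := fun i w hw => by
    rcases mem_insert.1 hw with rfl | hw
    · exact ⟨.nil, by simp⟩
    · exact ⟨.cons ((F.mem_neighborFinset _ _).1 hw) .nil, by simp⟩
  have hdisj : ∀ i j, i + 3 ≤ j → j ≤ p.length → Disjoint (B i) (B j) := fun i j hij hj => by
    refine disjoint_left.2 fun w hwi hwj => ?_
    obtain ⟨q₁, h₁⟩ := hBwalk i w hwi
    obtain ⟨q₂, h₂⟩ := hBwalk j w hwj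
    have := SimpleGraph.dist_le ((p.take i).append (q₁.append (q₂.reverse.append (p.drop j))))
    simp only [SimpleGraph.Walk.length_append, SimpleGraph.Walk.length_reverse,
      SimpleGraph.Walk.take_length, SimpleGraph.Walk.drop_length] at this
    omega
  have hunion := card_le_univ (B 0 ∪ B 3 ∪ B 6)
  rw [card_union_of_disjoint (disjoint_union_left.2
    ⟨hdisj 0 6 (by omega) (by omega), hdisj 3 6 (by omega) (by omega)⟩),
    card_union_of_disjoint (hdisj 0 3 (by omega) (by omega))] at hunion
  have := hBcard 0
  have := hBcard 3
  have := hBcard 6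
  omega

theorem degree_induce_coe (G : SimpleGraph V) (S : Finset V) (x : (S : Set V)) :
    (G.induce (S : Set V)).degree x = #{y ∈ S | G.Adj x y} := by
  rw [← SimpleGraph.card_neighborFinset_eq_degree,
    ← card_map (Function.Embedding.subtype (· ∈ (S : Set V)))]
  congr 1
  ext y
  simp [and_comm]

theorem exists_walk_of_reachable_induce {S : Finset V} {d : ℕ}
    (hd : ∀ x ∈ S, d ≤ #{y ∈ S | G.Adj x y}) (hS : #S < 3 * (d + 1)) {x y : (S : Set V)}
    (hxy : (G.induce (S : Set V)).Reachable x y) :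
    ∃ p : G.Walk x y, p.length ≤ 5 ∧ ∀ v ∈ p.support, v ∈ S := by
  obtain ⟨p, hp⟩ := hxy.exists_walk_length_eq_dist
  have hdist := dist_le_five_of_card_lt (d := d)
    (fun v => (degree_induce_coe G S v).symm ▸ hd v v.2) (by simpa using hS) hxy
  let f : G.induce (S : Set V) →g G := (SimpleGraph.Embedding.induce _).toHom
  refine ⟨p.map f, (p.length_map f).trans_le (hp.trans_le hdist), fun v hv => ?_⟩
  obtain ⟨w, -, rfl⟩ := List.mem_map.1 ((p.support_map f).symm ▸ hv : v ∈ p.support.map f)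
  exact w.2

theorem exists_subset_closed_of_not_reachable {S : Finset V} {n : ℕ} (hS : #S ≤ 2 * n)
    {x y : (S : Set V)} (hxy : ¬ (G.induce (S : Set V)).Reachable x y) :
    ∃ Q ⊆ S, Q.Nonempty ∧ #Q ≤ n ∧ ∀ v ∈ Q, ∀ w ∈ S, G.Adj v w → w ∈ Q := by
  let P : V → Prop := fun v => ∃ h : v ∈ (S : Set V), (G.induce (S : Set V)).Reachable x ⟨v, h⟩
  have hP : ∀ v ∈ S, ∀ w ∈ S, G.Adj v w → P v → P w := fun v _ w hw hvw ⟨hv, hxv⟩ =>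
    ⟨hw, hxv.trans (SimpleGraph.Adj.reachable (G := G.induce (S : Set V))
      (u := ⟨v, hv⟩) (v := ⟨w, hw⟩) hvw)⟩
  have hcard : #{v ∈ S | P v} + #{v ∈ S | ¬ P v} = #S := card_filter_add_card_filter_not _
  by_cases hsmall : #{v ∈ S | P v} ≤ n
  · refine ⟨{v ∈ S | P v}, filter_subset _ _, ⟨x, ?_⟩, hsmall, fun v hv w hw hvw => ?_⟩
    · exact mem_filter.2 ⟨x.2, x.2, SimpleGraph.Reachable.refl _⟩
    · obtain ⟨hvS, hPv⟩ := mem_filter.1 hv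
      exact mem_filter.2 ⟨hw, hP v hvS w hw hvw hPv⟩
  · refine ⟨{v ∈ S | ¬ P v}, filter_subset _ _, ⟨y, ?_⟩, by omega, fun v hv w hw hvw => ?_⟩
    · exact mem_filter.2 ⟨y.2, fun ⟨_, h⟩ => hxy h⟩
    · obtain ⟨hvS, hPv⟩ := mem_filter.1 hv
      exact mem_filter.2 ⟨hw, fun hPw => hPv (hP w hw v hvS hvw.symm hPw)⟩

theorem le_card_neighbors_add_of_closed {d K : ℕ} {H Z Q : Finset V}
    (hd : ∀ x ∈ H, d ≤ #{y ∈ H | G.Adj x y}) (hZ : #Z ≤ K) (hQ : Q ⊆ H \ Z)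
    (hclosed : ∀ v ∈ Q, ∀ w ∈ H \ Z, G.Adj v w → w ∈ Q) {x : V} (hx : x ∈ Q) :
    d ≤ #{y ∈ Q | G.Adj x y} + K := by
  suffices {y ∈ H | G.Adj x y} ⊆ {y ∈ Q | G.Adj x y} ∪ Z from
    (hd x (mem_sdiff.1 (hQ hx)).1).trans ((card_le_card this).trans
      ((card_union_le _ _).trans (Nat.add_le_add_left hZ _)))
  intro y hy
  obtain ⟨hyH, hxy⟩ := mem_filter.1 hy
  by_cases hyZ : y ∈ Z
  · exact mem_union_right _ hyZ
  · exact mem_union_left _ (mem_filter.2 ⟨hclosed x hx y (mem_sdiff.2 ⟨hyH, hyZ⟩) hxy, hxy⟩)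

/- Either `H` itself is robust, or some `K` vertices separate a part of at most `n` vertices, which
is so small that its vertices have many common neighbours. -/
theorem exists_robust {n d K : ℕ} {H : Finset V} (hH : H.Nonempty) (hn : #H ≤ 2 * n)
    (hd : ∀ x ∈ H, d ≤ #{y ∈ H | G.Adj x y}) (h₁ : 2 * n + 3 * K < 3 * (d + 1))
    (h₂ : n + 3 * K < 2 * d) :
    ∃ U ⊆ H, U.Nonempty ∧ Robust G K U ∧ ∀ x ∈ U, d ≤ #{y ∈ U | G.Adj x y} + K := by
  by_cases hconn : ∀ Z : Finset V, #Z ≤ K → ∀ x y : ((H \ Z : Finset V) : Set V),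
      (G.induce ((H \ Z : Finset V) : Set V)).Reachable x y
  · refine ⟨H, subset_rfl, hH, fun Z hZ x hx y hy => ?_, fun x hx => le_add_right (hd x hx)⟩
    have hdZ : ∀ v ∈ H \ Z, d - K ≤ #{w ∈ H \ Z | G.Adj v w} := fun v hv =>
      Nat.sub_le_of_le_add
        (le_card_neighbors_add_of_closed hd hZ subset_rfl (fun _ _ _ h _ => h) hv)
    have hcard := card_le_card (sdiff_subset : H \ Z ⊆ H)
    exact exists_walk_of_reachable_induce hdZ (by omega) (hconn Z hZ ⟨x, hx⟩ ⟨y, hy⟩)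
  · push Not at hconn
    obtain ⟨Z, hZ, x, y, hxy⟩ := hconn
    obtain ⟨Q, hQ, hQne, hQn, hclosed⟩ :=
      exists_subset_closed_of_not_reachable ((card_le_card sdiff_subset).trans hn) hxy
    have hdQ : ∀ v ∈ Q, d ≤ #{w ∈ Q | G.Adj v w} + K := fun v hv =>
      le_card_neighbors_add_of_closed hd hZ hQ hclosed hv
    exact ⟨Q, hQ.trans sdiff_subset, hQne, robust_of_card_lt
      (fun v hv => Nat.sub_le_of_le_add (hdQ v hv)) (by omega), hdQ⟩

end Robust

/-! ### Massed pairs are linked -/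

section Touch

variable {V : Type u} [Fintype V] {G : SimpleGraph V} {D : Finset V} {u v : V}

theorem touch_empty (G : SimpleGraph V) : touch G ∅ = 0 :=
  card_eq_zero.2 (filter_eq_empty_iff.2 (by simp))

theorem pairsMeeting_mono_left {G' : SimpleGraph V} (h : G' ≤ G) (D : Finset V) :
    pairsMeeting G' D ⊆ pairsMeeting G D := fun _ hp =>
  mem_pairsMeeting.2 ((mem_pairsMeeting.1 hp).imp_left (@h _ _))

theorem touch_le_touch_deleteEdges_add_two (G : SimpleGraph V) (D : Finset V) (a b : V) :
    touch G D ≤ touch (G.deleteEdges {s(a, b)}) D + 2 := by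
  suffices pairsMeeting G D ⊆ pairsMeeting (G.deleteEdges {s(a, b)}) D ∪ {(a, b), (b, a)} from
    (card_le_card this).trans ((card_union_le _ _).trans (Nat.add_le_add_left card_le_two _))
  intro p hp
  obtain ⟨hp, hpD⟩ := mem_pairsMeeting.1 hp
  by_cases h : s(p.1, p.2) = s(a, b)
  · exact mem_union_right _ (by simpa [Prod.ext_iff] using Sym2.eq_iff.1 h)
  · exact mem_union_left _ (mem_pairsMeeting.2 ⟨SimpleGraph.deleteEdges_adj.2 ⟨hp, h⟩, hpD⟩)

theorem touch_deleteEdges_lt {a b : V} (hab : G.Adj a b) (ha : a ∈ D) :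
    touch (G.deleteEdges {s(a, b)}) D < touch G D := by
  refine card_lt_card ⟨pairsMeeting_mono_left (G.deleteEdges_le _) D, fun hsub => ?_⟩
  have hmem := hsub (mem_pairsMeeting.2 ⟨hab, Or.inl ha⟩ : (a, b) ∈ _)
  exact (SimpleGraph.deleteEdges_adj.1 (mem_pairsMeeting.1 hmem).1).2 rfl

theorem sum_degree_le_touch (G : SimpleGraph V) (D : Finset V) :
    ∑ v ∈ D, G.degree v ≤ touch G D := by
  simp_rw [← G.card_neighborFinset_eq_degree]
  rw [← card_sigma]
  refine card_le_card_of_injOn (fun p => (p.1, p.2)) (fun p hp => ?_) fun p _ q _ h => ?_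
  · obtain ⟨hp1, hp2⟩ := mem_sigma.1 (mem_coe.1 hp)
    exact mem_coe.2 (mem_pairsMeeting.2 ⟨(G.mem_neighborFinset _ _).1 hp2, Or.inl hp1⟩)
  · obtain ⟨h1, h2⟩ := Prod.ext_iff.1 h
    exact Sigma.ext h1 (heq_of_eq h2)

theorem touch_le_touch_erase_add_degree (G : SimpleGraph V) (D : Finset V) (v : V) :
    touch G D ≤ touch G (D.erase v) + 2 * G.degree v := by
  suffices pairsMeeting G D ⊆ pairsMeeting G (D.erase v) ∪
      ({v} ×ˢ G.neighborFinset v ∪ G.neighborFinset v ×ˢ {v}) by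
    grw [touch, this, card_union_le, card_union_le, card_product, card_product, card_singleton,
      G.card_neighborFinset_eq_degree, one_mul, mul_one, two_mul, touch]
  intro p hp
  obtain ⟨hp, hpD⟩ := mem_pairsMeeting.1 hp
  simp only [mem_union, mem_pairsMeeting, mem_product, mem_singleton,
    SimpleGraph.mem_neighborFinset, mem_erase]
  by_cases h1 : p.1 = v
  · exact Or.inr (Or.inl ⟨h1, h1 ▸ hp⟩)
  · by_cases h2 : p.2 = v
    · exact Or.inr (Or.inr ⟨h2 ▸ hp.symm, h2⟩)
    · exact Or.inl ⟨hp, hpD.imp (⟨h1, ·⟩) (⟨h2, ·⟩)⟩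

theorem notMem_boundary_contract : v ∉ boundary (contract G u v) D := fun h =>
  have ⟨_, _, _, hdv⟩ := mem_boundary.1 h
  hdv.2.2.1 rfl

theorem boundary_subset_insert_boundary_contract (hv : v ∉ D) :
    boundary G D ⊆ insert v (boundary (contract G u v) D) := by
  intro x hx
  obtain ⟨hxD, d, hd, hdx⟩ := mem_boundary.1 hx
  refine mem_insert.2 (or_iff_not_imp_left.2 fun hxv => mem_boundary.2 ⟨hxD, d, hd, hdx.ne, ?_⟩)
  exact ⟨ne_of_mem_of_not_mem hd hv, hxv, Or.inl hdx⟩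

theorem boundary_insert_eq_boundary_contract (huv : G.Adj u v) (hu : u ∈ D) (hv : v ∉ D) :
    boundary G (insert v D) = boundary (contract G u v) D := by
  ext x
  constructor
  · intro hx
    obtain ⟨hxvD, d, hd, hdx⟩ := mem_boundary.1 hx
    rw [mem_insert, not_or] at hxvD
    rcases mem_insert.1 hd with rfl | hd
    · exact mem_boundary.2 ⟨hxvD.2, u, hu, (ne_of_mem_of_not_mem hu hxvD.2), huv.ne, hxvD.1,
        Or.inr (Or.inl ⟨rfl, hdx⟩)⟩
    · exact mem_of_mem_insert_of_ne (boundary_subset_insert_boundary_contract hv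
        (mem_boundary.2 ⟨hxvD.2, d, hd, hdx⟩)) hxvD.1
  · intro hx
    obtain ⟨hxD, d, hd, -, -, hxv, hdx⟩ := mem_boundary.1 hx
    have hxvD : x ∉ insert v D := by simp [hxD, hxv]
    rcases hdx with hdx | ⟨-, hvx⟩ | ⟨rfl, -⟩
    · exact mem_boundary.2 ⟨hxvD, d, mem_insert_of_mem hd, hdx⟩
    · exact mem_boundary.2 ⟨hxvD, v, mem_insert_self _ _, hvx⟩
    · exact absurd hu hxD

theorem touch_contract_le (hu : u ∉ D) : touch (contract G u v) D ≤ touch G D := by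
  let π : V → V := fun a => if a = v then u else a
  have π_of_ne : ∀ a, a ≠ v → π a = a := fun a ha => if_neg ha
  have π_v : π v = u := if_pos rfl
  refine (card_le_card fun p hp => ?_).trans (card_image_le (f := Prod.map π π))
  obtain ⟨x, y⟩ := p
  obtain ⟨⟨-, hxv, hyv, h⟩, hxy⟩ := mem_pairsMeeting.1 hp
  simp only [mem_image, mem_pairsMeeting, Prod.exists, Prod.map_apply, Prod.mk.injEq]
  rcases h with h | ⟨rfl, h⟩ | ⟨rfl, h⟩
  · exact ⟨x, y, ⟨h, hxy⟩, π_of_ne x hxv, π_of_ne y hyv⟩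
  · exact ⟨v, y, ⟨h, Or.inr (hxy.resolve_left hu)⟩, π_v, π_of_ne y hyv⟩
  · exact ⟨x, v, ⟨h.symm, Or.inl (hxy.resolve_right hu)⟩, π_of_ne x hxv, π_v⟩

/- An edge at `v` survives the contraction unless its other end is `u` or a neighbour of `u`. -/
theorem touch_le_touch_contract_add (hu : u ∈ D) (huv : G.Adj u v) :
    touch G D ≤ touch (contract G u v) (D.erase v) +
      2 * (#(G.neighborFinset u ∩ G.neighborFinset v) + 1) := by
  let lift : V × V → V × V := fun p => if G.Adj p.1 p.2 then p else
    (if p.1 = u then v else p.1, if p.2 = u then v else p.2)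
  let N := insert u (G.neighborFinset u ∩ G.neighborFinset v)
  have hN : #({v} ×ˢ N ∪ N ×ˢ {v}) ≤ 2 * (#(G.neighborFinset u ∩ G.neighborFinset v) + 1) := by
    grw [card_union_le, card_product, card_product, card_singleton, card_insert_le, one_mul,
      mul_one, two_mul]
  suffices pairsMeeting G D ⊆
      (pairsMeeting (contract G u v) (D.erase v)).image lift ∪ ({v} ×ˢ N ∪ N ×ˢ {v}) from
    (card_le_card this).trans ((card_union_le _ _).trans (add_le_add card_image_le hN))
  rintro ⟨x, y⟩ hp
  obtain ⟨hxy, hD⟩ := mem_pairsMeeting.1 hp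
  refine mem_union.2 (or_iff_not_imp_right.2 fun hpN => ?_)
  simp only [mem_union, mem_product, mem_singleton, N, mem_insert, mem_inter,
    SimpleGraph.mem_neighborFinset, not_or, not_and] at hpN
  simp only [mem_image, mem_pairsMeeting, mem_erase, Prod.exists]
  by_cases hx : x = v
  · subst hx
    obtain ⟨hyu, hy⟩ := hpN.1 rfl
    exact ⟨u, y, ⟨⟨Ne.symm hyu, huv.ne, hxy.ne', Or.inr (Or.inl ⟨rfl, hxy⟩)⟩,
      Or.inl ⟨huv.ne, hu⟩⟩, by simp [lift, hyu, mt hy (not_not.2 hxy)]⟩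
  by_cases hy : y = v
  · subst hy
    have hxu : x ≠ u := fun h => hpN.2 (Or.inl h) rfl
    have hux : ¬ G.Adj x u := fun h => hpN.2 (Or.inr ⟨h.symm, hxy.symm⟩) rfl
    exact ⟨x, u, ⟨⟨hxu, hx, huv.ne, Or.inr (Or.inr ⟨rfl, hxy.symm⟩)⟩, Or.inr ⟨huv.ne, hu⟩⟩,
      by simp [lift, hxu, hux]⟩
  · exact ⟨x, y, ⟨⟨hxy.ne, hx, hy, Or.inl hxy⟩, hD.imp (⟨hx, ·⟩) (⟨hy, ·⟩)⟩, by simp [lift, hxy]⟩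

end Touch

section MassedLinked

variable {V : Type u} [Fintype V] {G : SimpleGraph V} {D R X U : Finset V} {Λ m : ℕ} {u v : V}

theorem separator_eq_boundary {T E : Finset V} (h : ∀ v ∈ T, ∃ w ∈ E, G.Adj v w) :
    separator G T E = boundary G E := by
  ext v
  rw [mem_separator, mem_boundary]
  refine and_congr_right fun _ => or_iff_right_of_imp fun hv => ?_
  obtain ⟨w, hw, hvw⟩ := h v hv
  exact ⟨w, hw, hvw.symm⟩

theorem Robust.exists_boundaryLinked {K : ℕ} (hU : Robust G K U) (hUR : U ⊆ R) (hne : U.Nonempty)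
    (hK : 7 * #(boundary G R) ≤ K)
    (hdeg : ∀ x ∈ U, #(boundary G R) < #{y ∈ U | G.Adj x y}) :
    ∃ E ⊆ R, E.Nonempty ∧ #(boundary G E) ≤ #(boundary G R) ∧ BoundaryLinked G E := by
  obtain ⟨E, hE, hmin⟩ := exists_min_image R.powerset (fun E => #(separator G U E))
    ⟨R, mem_powerset_self R⟩
  rw [mem_powerset] at hE
  have hsepR : separator G U R = boundary G R := by
    rw [separator, sdiff_eq_empty_iff_subset.2 hUR, union_empty]
  have hsepE : #(separator G U E) ≤ #(boundary G R) :=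
    hsepR ▸ hmin R (mem_powerset_self R)
  have hUE : ∀ v ∈ U, v ∉ separator G U E → v ∈ E := fun v hv hvsep => by
    by_contra hvE
    exact hvsep (mem_separator.2 ⟨hvE, Or.inl hv⟩)
  have hadj : ∀ v ∈ U, ∃ w ∈ E, G.Adj v w := fun v hv => by
    obtain ⟨w, hw, hwsep⟩ := exists_mem_notMem_of_card_lt_card (hsepE.trans_lt (hdeg v hv))
    obtain ⟨hwU, hvw⟩ := mem_filter.1 hw
    exact ⟨w, hUE w hwU hwsep, hvw⟩
  have heq := separator_eq_boundary hadj
  obtain ⟨x, hx⟩ := hne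
  obtain ⟨w, hw, -⟩ := hadj x hx
  refine ⟨E, hE, ⟨w, hw⟩, heq ▸ hsepE, ?_⟩
  rw [BoundaryLinked, ← heq]
  refine linked_of_separator_minimal le_rfl
    (fun E' hE' => hmin E' (mem_powerset.2 (hE'.trans hE)))
    (fun S hS hcard => hU.linked hS (by omega)) (fun a ha _ => ha) (fun a ha _ _ => ha) subset_rfl
    fun v hv => mem_union.2 (or_iff_not_imp_right.2 (hUE v hv))

/-- A massed pair that is not linked, although `|X| ≤ m`, and is minimal with this property: first
`|R|` is minimal, and then the number of edges that meet `R`. -/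
structure MinimalUnlinked (Λ m : ℕ) (G : SimpleGraph V) (R X : Finset V) : Prop
    extends Massed Λ G R X where
  card_le : #X ≤ m
  not_linked : ¬ Linked G (R ∪ X) X
  linkedBelow : MassedLinkedBelow V Λ m #R
  linked_of_touch_lt : ∀ G' : SimpleGraph V, touch G' R < touch G R → Massed Λ G' R X →
    Linked G' (R ∪ X) X

namespace MinimalUnlinked

theorem nonempty (h : MinimalUnlinked Λ m G R X) : R.Nonempty := by
  rw [nonempty_iff_ne_empty]
  rintro rfl
  simpa [touch_empty] using h.lt_touch

theorem not_boundaryLinked (h : MinimalUnlinked Λ m G R X) (hDR : D ⊆ R) (hD : D.Nonempty)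
    (hDX : #(boundary G D) ≤ #X) : ¬ BoundaryLinked G D := fun hL =>
  h.not_linked (h.linked_of_boundaryLinked h.linkedBelow h.card_le hDR hD hDX hL)

theorem touch_le_of_ssubset (h : MinimalUnlinked Λ m G R X) (hDR : D ⊂ R)
    (hDX : #(boundary G D) ≤ #X) : touch G D ≤ Λ * #D := by
  by_contra! hlt
  obtain ⟨D', hD', hcard, hM⟩ := exists_massed_of_lt_touch hlt
  have hne : D'.Nonempty := by
    rw [nonempty_iff_ne_empty]
    rintro rfl
    simpa [touch_empty] using hM.lt_touch
  refine h.not_boundaryLinked (hD'.trans hDR.subset) hne (hcard.trans hDX) ?_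
  exact h.linkedBelow _ _ _ ((card_le_card hD').trans_lt (card_lt_card hDR))
    (hcard.trans (hDX.trans h.card_le)) hM

theorem exists_adj_mem (h : MinimalUnlinked Λ m G R X) (hΛ : 2 * m ≤ Λ) (hv : v ∈ R) :
    ∃ w ∈ R, G.Adj v w := by
  by_contra! hvR
  have hboundary : boundary G (R.erase v) ⊆ X := fun x hx => by
    obtain ⟨hxRv, d, hd, hdx⟩ := mem_boundary.1 hx
    have hdR := mem_of_mem_erase hd
    refine h.boundary_subset (mem_boundary.2 ⟨fun hxR => ?_, d, hdR, hdx⟩)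
    obtain rfl : x = v := by
      by_contra hxv
      exact hxRv (mem_erase.2 ⟨hxv, hxR⟩)
    exact hvR d hdR hdx.symm
  have hdegree : G.degree v ≤ #X := card_le_card fun w hw => by
    rw [SimpleGraph.mem_neighborFinset] at hw
    exact h.boundary_subset (mem_boundary.2 ⟨fun hwR => hvR w hwR hw, v, hv, hw⟩)
  have herase := h.touch_le_of_ssubset (erase_ssubset hv) (card_le_card hboundary)
  have htouch := touch_le_touch_erase_add_degree G R v
  have hlt := h.lt_touch
  have hX := h.card_le
  rw [← card_erase_add_one hv, mul_add] at hlt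
  omega

theorem touch_le_add_two (h : MinimalUnlinked Λ m G R X) (hΛ : 2 * m ≤ Λ) :
    touch G R ≤ Λ * #R + 2 := by
  by_contra! hlt
  obtain ⟨a, ha⟩ := h.nonempty
  obtain ⟨b, hb, hab⟩ := h.exists_adj_mem hΛ ha
  have hboundary : boundary (G.deleteEdges {s(a, b)}) R = X :=
    (boundary_deleteEdges_of_mem ha hb).trans h.boundary_eq
  have htouch := touch_le_touch_deleteEdges_add_two G R a b
  refine h.not_linked (Linked.mono (h.linked_of_touch_lt _ (touch_deleteEdges_lt hab ha)
    ⟨h.disjoint, hboundary.le, by omega, fun D hDR hDX => ?_⟩) (G.deleteEdges_le _) subset_rfl)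
  have hne : D ≠ R := by
    rintro rfl
    exact hDX.ne (congrArg card hboundary)
  obtain ⟨z, hz⟩ := exists_boundary_subset_insert_deleteEdges G D a b
  have hcard := (card_le_card hz).trans (card_insert_le _ _)
  exact (card_le_card (pairsMeeting_mono_left (G.deleteEdges_le _) D)).trans
    (h.touch_le_of_ssubset (hDR.ssubset_of_ne hne) (by omega))

theorem touch_contract_le (h : MinimalUnlinked Λ m G R X) (hv : v ∈ R) (huv : G.Adj u v)
    (hD : D ⊆ R.erase v) (hDX : #(boundary (contract G u v) D) < #X) :
    touch (contract G u v) D ≤ Λ * #D := by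
  by_contra! hlt
  obtain ⟨D', hD', hcard, hM⟩ := exists_massed_of_lt_touch hlt
  have hD'v : v ∉ D' := fun h => notMem_erase v R (hD (hD' h))
  have hD'R : D' ⊂ R := (hD'.trans hD).trans_ssubset (erase_ssubset hv)
  by_cases hu : u ∈ D'
  · have hboundary := boundary_insert_eq_boundary_contract huv hu hD'v
    refine h.not_boundaryLinked (insert_subset hv hD'R.subset) (insert_nonempty v D')
      (hboundary ▸ by omega) ?_
    rw [BoundaryLinked, hboundary, insert_union]
    exact (h.linkedBelow _ _ _ (card_lt_card hD'R) ((hcard.trans hDX.le).trans h.card_le)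
      hM).of_contract huv (mem_union_left _ hu) notMem_boundary_contract
  · have hboundary := (card_le_card (boundary_subset_insert_boundary_contract (u := u) (G := G)
      hD'v)).trans (card_insert_le _ _)
    have hle := h.touch_le_of_ssubset hD'R (by omega)
    exact hM.lt_touch.not_ge ((DefectiveColouring.touch_contract_le hu).trans hle)

theorem lt_card_common_neighbors (h : MinimalUnlinked Λ m G R X) (hu : u ∈ R) (hv : v ∈ R)
    (huv : G.Adj u v) : Λ < 2 * (#(G.neighborFinset u ∩ G.neighborFinset v) + 1) := by
  by_contra! hle
  have hcard := card_erase_add_one hv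
  have huRv : u ∈ R.erase v := mem_erase.2 ⟨huv.ne, hu⟩
  have hM : Massed Λ (contract G u v) (R.erase v) X := by
    refine ⟨disjoint_of_subset_left (erase_subset _ _) h.disjoint, ?_, ?_,
      fun D => h.touch_contract_le hv huv⟩
    · rw [← boundary_insert_eq_boundary_contract huv huRv (notMem_erase v R), insert_erase hv]
      exact h.boundary_subset
    · have htouch := touch_le_touch_contract_add hu huv
      have hlt := h.lt_touch
      rw [← hcard, mul_add] at hlt
      omega
  have hL := (h.linkedBelow _ _ _ (by omega) h.card_le hM).of_contract huv (mem_union_left _ huRv)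
    (disjoint_left.1 h.disjoint hv)
  rw [← insert_union, insert_erase hv] at hL
  exact h.not_linked hL

theorem exists_degree_le (h : MinimalUnlinked Λ m G R X) (hΛ : 2 * m ≤ Λ) :
    ∃ v ∈ R, G.degree v ≤ Λ + 2 := by
  by_contra! hlt
  have hsum := card_nsmul_le_sum R _ (Λ + 3) hlt
  have hle := hsum.trans ((sum_degree_le_touch G R).trans (h.touch_le_add_two hΛ))
  have hpos := h.nonempty.card_pos
  rw [smul_eq_mul, mul_add, mul_comm] at hle
  omega

/- The neighbourhood in `R` of a vertex of small degree has large minimum degree, hence contains a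
robust set. -/
theorem false_of_le {lam : ℕ} (h : MinimalUnlinked (2 * lam) m G R X) (hlam : 24 * m + 2 ≤ lam) :
    False := by
  obtain ⟨v, hv, hdeg⟩ := h.exists_degree_le (by omega)
  let H : Finset V := {w ∈ R | G.Adj v w}
  have hH : H.Nonempty := by
    obtain ⟨w, hw, hvw⟩ := h.exists_adj_mem (by omega) hv
    exact ⟨w, mem_filter.2 ⟨hw, hvw⟩⟩
  have hHcard : #H ≤ 2 * (lam + 1) := by
    refine (card_le_card fun w hw => ?_).trans hdeg
    exact (G.mem_neighborFinset v w).2 (mem_filter.1 hw).2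
  have hHdeg : ∀ x ∈ H, lam - m ≤ #{y ∈ H | G.Adj x y} := fun x hx => by
    obtain ⟨hxR, hvx⟩ := mem_filter.1 hx
    have hcommon := h.lt_card_common_neighbors hv hxR hvx
    have hsub : G.neighborFinset v ∩ G.neighborFinset x ⊆ {y ∈ H | G.Adj x y} ∪ X := fun z hz => by
      rw [mem_inter, SimpleGraph.mem_neighborFinset, SimpleGraph.mem_neighborFinset] at hz
      by_cases hzR : z ∈ R
      · exact mem_union_left _ (mem_filter.2 ⟨mem_filter.2 ⟨hzR, hz.1⟩, hz.2⟩)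
      · exact mem_union_right _ (h.boundary_subset (mem_boundary.2 ⟨hzR, v, hv, hz.1⟩))
    have hle := (card_le_card hsub).trans (card_union_le _ _)
    have hX := h.card_le
    omega
  have hboundary : #(boundary G R) ≤ m := h.boundary_eq ▸ h.card_le
  obtain ⟨U, hUH, hUne, hU, hUdeg⟩ :=
    exists_robust (K := 7 * m) hH hHcard hHdeg (by omega) (by omega)
  obtain ⟨E, hER, hEne, hEcard, hE⟩ := hU.exists_boundaryLinked (hUH.trans (filter_subset _ _))
    hUne (by omega) fun x hx => by
      have := hUdeg x hx
      omega
  exact h.not_boundaryLinked hER hEne (h.boundary_eq ▸ hEcard) hE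

end MinimalUnlinked

theorem Massed.linked {lam : ℕ} (hlam : 24 * m + 2 ≤ lam) (hM : Massed (2 * lam) G R X)
    (hX : #X ≤ m) : Linked G (R ∪ X) X := by
  induction hR : #R using Nat.strong_induction_on generalizing G R X with
  | _ r ihR =>
  induction ht : touch G R using Nat.strong_induction_on generalizing G with
  | _ t iht =>
  by_contra hnot
  refine MinimalUnlinked.false_of_le ⟨hM, hX, hnot, fun G' R' X' hR' hX' hM' => ?_,
    fun G' hG' hM' => iht _ (ht ▸ hG') hM' rfl⟩ hlam
  exact ihR _ (hR ▸ hR') hM' hX' rfl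

end MassedLinked

/-! ### Subdivision models -/

section SubdivisionModel

variable {V : Type u} {W : Type v} {H : SimpleGraph W} {G : SimpleGraph V}

/-- A subdivision of `H` in `G`, given by its branch vertices and, for each edge of `H`, a set that
contains a path between the two branch vertices. Only the values of `part` at the edges of `H`
matter. -/
structure SubdivisionModel (H : SimpleGraph W) (G : SimpleGraph V) where
  branch : W → V
  branch_injective : Function.Injective branch
  part : Sym2 W → Set V
  exists_walk : ∀ a b, H.Adj a b →
    ∃ p : G.Walk (branch a) (branch b), ∀ v ∈ p.support, v ∈ part s(a, b)
  mem_of_branch_mem_part : ∀ e ∈ H.edgeSet, ∀ w, branch w ∈ part e → w ∈ e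
  mem_range_branch : ∀ e ∈ H.edgeSet, ∀ e' ∈ H.edgeSet, e ≠ e' →
    part e ∩ part e' ⊆ Set.range branch

namespace SubdivisionModel

theorem exists_symm_paths (M : SubdivisionModel H G) :
    ∃ P : ∀ a b, H.Adj a b → G.Walk (M.branch a) (M.branch b),
      (∀ a b h, (P a b h).IsPath) ∧ (∀ a b h, P b a h.symm = (P a b h).reverse) ∧
      ∀ a b h, ∀ v ∈ (P a b h).support, v ∈ M.part s(a, b) := by
  have hpath : ∀ a b, H.Adj a b → ∃ p : G.Walk (M.branch a) (M.branch b),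
      p.IsPath ∧ ∀ v ∈ p.support, v ∈ M.part s(a, b) := fun a b h => by
    obtain ⟨p, hp⟩ := M.exists_walk a b h
    exact ⟨p.bypass, p.bypass_isPath, fun v hv => hp v (p.support_bypass_subset_support hv)⟩
  choose p hp hpart using hpath
  -- A linear order on `W` orients the edges of `H`.
  let _ : LinearOrder W := IsWellOrder.linearOrder WellOrderingRel
  refine ⟨fun a b h => if a < b then p a b h else (p b a h.symm).reverse, fun a b h => ?_,
    fun a b h => ?_, fun a b h v hv => ?_⟩
  · dsimp only
    split_ifs
    exacts [hp a b h, (hp b a h.symm).reverse]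
  · rcases h.ne.lt_or_gt with hab | hab
    · simp only [hab, hab.not_gt, if_true, if_false]
    · simp only [hab, hab.not_gt, if_true, if_false, SimpleGraph.Walk.reverse_reverse]
  · dsimp only at hv
    split_ifs at hv
    · exact hpart a b h v hv
    · rw [SimpleGraph.Walk.support_reverse, List.mem_reverse] at hv
      exact Sym2.eq_swap (a := a) (b := b) ▸ hpart b a h.symm v hv

theorem isTopologicalMinor (M : SubdivisionModel H G) : IsTopologicalMinor H G := by
  obtain ⟨P, hpath, hsymm, hpart⟩ := M.exists_symm_paths
  let S : G.Subgraph :=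
    { verts := {x | x ∈ Set.range M.branch ∨ ∃ a b, ∃ h, x ∈ (P a b h).support}
      Adj := fun x y => ∃ a b, ∃ h, s(x, y) ∈ (P a b h).edges
      adj_sub := fun ⟨a, b, h, hxy⟩ => (P a b h).adj_of_mem_edges hxy
      edge_vert := fun ⟨a, b, h, hxy⟩ =>
        Or.inr ⟨a, b, h, SimpleGraph.Walk.fst_mem_support_of_mem_edges _ hxy⟩
      symm := ⟨fun x y ⟨a, b, h, hxy⟩ => ⟨a, b, h, Sym2.eq_swap ▸ hxy⟩⟩ }
  exact ⟨S, M.branch, P, M.branch_injective, hpath, hsymm,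
    fun a b h w hw => Sym2.mem_iff.1 (M.mem_of_branch_mem_part s(a, b) h w (hpart a b h _ hw)),
    fun a b h a' b' h' hne x hx hx' => M.mem_range_branch s(a, b) h s(a', b') h' hne
      ⟨hpart a b h x hx, hpart a' b' h' x hx'⟩,
    fun _ => Iff.rfl, fun _ _ => Iff.rfl⟩

theorem nonempty_of_isContained (h : H.IsContained G) : Nonempty (SubdivisionModel H G) := by
  obtain ⟨f⟩ := h
  refine ⟨⟨f, f.injective, fun e => {v | ∃ w ∈ e, f w = v}, fun a b hab => ?_, ?_, ?_⟩⟩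
  · exact ⟨(f.toHom.map_adj hab).toWalk, by simp [or_comm]⟩
  · rintro e - w ⟨w', hw', hww'⟩
    exact f.injective hww' ▸ hw'
  · rintro e - e' - - v ⟨⟨w, -, hw⟩, -⟩
    exact ⟨w, hw⟩

theorem nonempty_mono {G' : SimpleGraph V} (hG : G ≤ G') :
    Nonempty (SubdivisionModel H G) → Nonempty (SubdivisionModel H G') := fun ⟨M⟩ =>
  ⟨⟨M.branch, M.branch_injective, M.part, fun a b h => by
    obtain ⟨p, hp⟩ := M.exists_walk a b h
    exact ⟨p.mapLe hG, by simpa using hp⟩, M.mem_of_branch_mem_part, M.mem_range_branch⟩⟩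

end SubdivisionModel

/-- `M` describes a graph on `B` whose edges are subdivided once in `G`: if `(a, e) ∈ M`, then the
edge `e` of that graph is replaced by the path of length two with inner vertex `a`. -/
structure SubdividesOnce (G : SimpleGraph V) (B : Finset V) (M : Finset (V × Sym2 V)) : Prop where
  notMem : ∀ p ∈ M, p.1 ∉ B
  not_isDiag : ∀ p ∈ M, ¬ p.2.IsDiag
  mem : ∀ p ∈ M, ∀ x ∈ p.2, x ∈ B
  adj : ∀ p ∈ M, ∀ x ∈ p.2, G.Adj p.1 x
  injOn_fst : Set.InjOn Prod.fst (M : Set (V × Sym2 V))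
  injOn_snd : Set.InjOn Prod.snd (M : Set (V × Sym2 V))

/-- The graph whose edges are subdivided according to `M`. -/
def subdividedGraph (M : Finset (V × Sym2 V)) : SimpleGraph V :=
  SimpleGraph.fromEdgeSet (Prod.snd '' (M : Set (V × Sym2 V)))

theorem subdividedGraph_adj {M : Finset (V × Sym2 V)} {x y : V} :
    (subdividedGraph M).Adj x y ↔ (∃ a, (a, s(x, y)) ∈ M) ∧ x ≠ y := by
  simp [subdividedGraph]

/-- The vertices of `S` in `B`, together with the inner vertices of the paths that replace the edges
within `S`. -/
def subdividedSet (B : Finset V) (M : Finset (V × Sym2 V)) (S : Set V) : Set V :=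
  {x | x ∈ S ∧ x ∈ B} ∪ {a | ∃ e, (a, e) ∈ M ∧ ∀ x ∈ e, x ∈ S}

namespace SubdividesOnce

variable {B : Finset V} {M : Finset (V × Sym2 V)}

theorem mem_of_mem_subdividedSet (hM : SubdividesOnce G B M) {S : Set V} {x : V}
    (hx : x ∈ subdividedSet B M S) (hxB : x ∈ B) : x ∈ S := by
  rcases hx with ⟨hxS, -⟩ | ⟨e, he, -⟩
  · exact hxS
  · exact absurd hxB (hM.notMem _ he)

theorem mem_of_adj (hM : SubdividesOnce G B M) {x y : V} (hxy : (subdividedGraph M).Adj x y) :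
    x ∈ B := by
  obtain ⟨⟨a, ha⟩, -⟩ := subdividedGraph_adj.1 hxy
  exact hM.mem _ ha x (Sym2.mem_mk_left x y)

theorem exists_walk (hM : SubdividesOnce G B M) {S : Set V} {x y : V}
    (p : (subdividedGraph M).Walk x y) (hx : x ∈ B) (hp : ∀ v ∈ p.support, v ∈ S) :
    ∃ q : G.Walk x y, ∀ v ∈ q.support, v ∈ subdividedSet B M S := by
  induction p with
  | nil =>
    refine ⟨.nil, ?_⟩
    simp only [SimpleGraph.Walk.support_nil, List.mem_singleton, forall_eq] at hp ⊢
    exact Or.inl ⟨hp, hx⟩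
  | @cons x y _ hxy p ih =>
    simp only [SimpleGraph.Walk.support_cons, List.mem_cons, forall_eq_or_imp] at hp
    obtain ⟨q, hq⟩ := ih (hM.mem_of_adj hxy.symm) hp.2
    obtain ⟨⟨a, ha⟩, -⟩ := subdividedGraph_adj.1 hxy
    have hax : G.Adj a x := hM.adj _ ha x (Sym2.mem_mk_left x y)
    have hay : G.Adj a y := hM.adj _ ha y (Sym2.mem_mk_right x y)
    have haS : a ∈ subdividedSet B M S :=
      Or.inr ⟨_, ha, Sym2.ball.2 ⟨hp.1, hp.2 _ p.start_mem_support⟩⟩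
    exact ⟨.cons hax.symm (.cons hay q), by
      simpa using ⟨(Or.inl ⟨hp.1, hx⟩ : x ∈ subdividedSet B M S), haS, hq⟩⟩

theorem nonempty_subdivisionModel (hM : SubdividesOnce G B M) (hH : ∀ a, ∃ b, H.Adj a b)
    (h : Nonempty (SubdivisionModel H (subdividedGraph M))) : Nonempty (SubdivisionModel H G) := by
  obtain ⟨N⟩ := h
  have hbranch : ∀ w, N.branch w ∈ B := fun a => by
    obtain ⟨b, hab⟩ := hH a
    obtain ⟨p, -⟩ := N.exists_walk a b hab
    obtain ⟨z, hz⟩ :=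
      p.reachable.nonempty_neighborSet_left (N.branch_injective.ne hab.ne)
    exact hM.mem_of_adj hz
  refine ⟨⟨N.branch, N.branch_injective, fun e => subdividedSet B M (N.part e),
    fun a b hab => ?_, fun e he w hw => ?_, fun e he e' he' hne => ?_⟩⟩
  · obtain ⟨p, hp⟩ := N.exists_walk a b hab
    exact hM.exists_walk p (hbranch a) hp
  · exact N.mem_of_branch_mem_part e he w (hM.mem_of_mem_subdividedSet hw (hbranch w))
  rintro v ⟨hv, hv'⟩
  by_cases hvB : v ∈ B
  · exact N.mem_range_branch e he e' he' hne
      ⟨hM.mem_of_mem_subdividedSet hv hvB, hM.mem_of_mem_subdividedSet hv' hvB⟩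
  -- The two ends of an edge within both parts are branch vertices `x ≠ y`, and `e = xy = e'`.
  obtain ⟨f, hf, hfe⟩ := hv.resolve_left fun h => hvB h.2
  obtain ⟨f', hf', hfe'⟩ := hv'.resolve_left fun h => hvB h.2
  obtain rfl : f = f' := congrArg Prod.snd (hM.injOn_fst hf hf' rfl)
  have hend : ∀ x ∈ f, ∃ w, N.branch w = x ∧ w ∈ e ∧ w ∈ e' := fun x hx => by
    obtain ⟨w, rfl⟩ := N.mem_range_branch e he e' he' hne ⟨hfe x hx, hfe' x hx⟩
    exact ⟨w, rfl, N.mem_of_branch_mem_part e he w (hfe _ hx),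
      N.mem_of_branch_mem_part e' he' w (hfe' _ hx)⟩
  have hdiag := hM.not_isDiag _ hf
  obtain ⟨x, y⟩ := f
  obtain ⟨w, rfl, hwe, hwe'⟩ := hend x (Sym2.mem_mk_left x y)
  obtain ⟨w', rfl, hwe₂, hwe₂'⟩ := hend y (Sym2.mem_mk_right _ y)
  have hww' : w ≠ w' := fun h => hdiag (congrArg N.branch h)
  exact absurd (Sym2.eq_of_ne_mem hww' hwe hwe₂ hwe' hwe₂') hne

end SubdividesOnce

end SubdivisionModel

/-! ### Dense graphs contain subdivisions -/

section MaderDense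

variable {V : Type u} {G : SimpleGraph V} {W : Finset V} {Γ q : ℕ}

/-- `W` is large and the subgraph that `G` induces on it has many edges; `#(G.interedges W W)` is
twice their number. As Mader observed, a minimal such `W` has large minimum degree and no small
separations. -/
def MaderDense (Γ q : ℕ) (G : SimpleGraph V) (W : Finset V) : Prop :=
  2 * q ≤ #W ∧ Γ * #W < #(G.interedges W W) + Γ * q

theorem maderDense_of_mul_le (hq : 1 ≤ q) (hΓ : 2 * q ≤ Γ) (hW : W.Nonempty)
    (h : Γ * #W ≤ #(G.interedges W W)) : MaderDense Γ q G W := by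
  have hle := h.trans (G.card_interedges_le_mul W W)
  have hpos : 0 < Γ * q := Nat.mul_pos (by omega) hq
  exact ⟨hΓ.trans (Nat.le_of_mul_le_mul_right hle hW.card_pos), by omega⟩

theorem card_interedges_le_card_interedges_erase (G : SimpleGraph V) (W : Finset V) (v : V) :
    #(G.interedges W W) ≤
      #(G.interedges (W.erase v) (W.erase v)) + 2 * #{w ∈ W | G.Adj v w} := by
  have hcover : G.interedges W W ⊆ G.interedges (W.erase v) (W.erase v) ∪
      ({v} ×ˢ {w ∈ W | G.Adj v w} ∪ {w ∈ W | G.Adj v w} ×ˢ {v}) := by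
    rintro ⟨x, y⟩ hp
    simp only [mem_union, SimpleGraph.mem_interedges_iff, mem_erase, mem_product, mem_singleton,
      mem_filter] at hp ⊢
    grind [G.adj_comm x y]
  grw [hcover, card_union_le, card_union_le, card_product, card_product, card_singleton]
  omega

namespace MaderDense

theorem card_lt (hΓ : 4 * q ≤ Γ) (h : MaderDense Γ q G W) : 2 * q < #W := by
  refine lt_of_le_of_ne h.1 fun heq => ?_
  have hlt := h.2
  grw [G.card_interedges_le_mul W W, ← heq] at hlt
  nlinarith

theorem lt_two_mul_degree (hΓ : 4 * q ≤ Γ) (h : Minimal (MaderDense Γ q G) W) {v : V}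
    (hv : v ∈ W) : Γ < 2 * #{w ∈ W | G.Adj v w} := by
  have hnot : ¬ MaderDense Γ q G (W.erase v) := h.not_prop_of_lt (erase_ssubset hv)
  have hcard := card_erase_add_one hv
  have hlt := card_lt hΓ h.prop
  have hsparse : #(G.interedges (W.erase v) (W.erase v)) + Γ * q ≤ Γ * #(W.erase v) :=
    not_lt.1 fun hd => hnot ⟨by omega, hd⟩
  have hle := card_interedges_le_card_interedges_erase G W v
  have hdense := h.prop.2
  rw [← hcard, mul_add] at hdense
  omega

theorem card_add_lt_of_separation (h : Minimal (MaderDense Γ q G) W) {A C : Finset V}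
    (hA : A ⊂ W) (hC : C ⊂ W) (hqA : 2 * q ≤ #A) (hqC : 2 * q ≤ #C)
    (hcover : ∀ a ∈ W, ∀ b ∈ W, G.Adj a b → a ∈ A ∧ b ∈ A ∨ a ∈ C ∧ b ∈ C) :
    #W + q < #A + #C := by
  have hsparse : ∀ W' ⊂ W, 2 * q ≤ #W' → #(G.interedges W' W') + Γ * q ≤ Γ * #W' :=
    fun W' hW' hq => not_lt.1 fun hd => h.not_prop_of_lt hW' ⟨hq, hd⟩
  have hle : #(G.interedges W W) ≤ #(G.interedges A A) + #(G.interedges C C) := by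
    grw [← card_union_le]
    refine card_le_card fun p hp => ?_
    simp only [mem_union, SimpleGraph.mem_interedges_iff] at hp ⊢
    have := hcover p.1 hp.1 p.2 hp.2.1 hp.2.2
    tauto
  by_contra! hsum
  have hsum' := Nat.mul_le_mul_left Γ hsum
  rw [mul_add, mul_add] at hsum'
  have := h.prop.2
  have := hsparse A hA hqA
  have := hsparse C hC hqC
  omega

end MaderDense

end MaderDense

section MaderLinked

variable {V : Type u} [Fintype V] {G : SimpleGraph V} {W B X : Finset V} {lam q : ℕ}

theorem avoid_compl_adj {S : Finset V} {a b : V} :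
    (avoid G Sᶜ).Adj a b ↔ G.Adj a b ∧ a ∈ S ∧ b ∈ S := by
  simp [avoid]

theorem boundary_avoid_compl_subset (G : SimpleGraph V) (S D : Finset V) :
    boundary (avoid G Sᶜ) D ⊆ S := fun v hv => by
  obtain ⟨-, d, -, hdv⟩ := mem_boundary.1 hv
  exact (avoid_compl_adj.1 hdv).2.2

theorem mem_union_boundary_avoid_compl {S D : Finset V} (hD : D ⊆ S) {a b : V} (ha : a ∈ D)
    (hb : b ∈ S) (hab : G.Adj a b) : b ∈ D ∪ boundary (avoid G Sᶜ) D :=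
  mem_union.2 <| or_iff_not_imp_left.2 fun hbD =>
    mem_boundary.2 ⟨hbD, a, ha, avoid_compl_adj.2 ⟨hab, hD ha, hb⟩⟩

theorem card_interedges_le_touch_add (G : SimpleGraph V) (W B X : Finset V) :
    #(G.interedges W W) ≤ touch (avoid G (W \ B)ᶜ) ((W \ B) \ X) + 2 * (#B + #X) * #W := by
  have hcover : G.interedges W W ⊆ pairsMeeting (avoid G (W \ B)ᶜ) ((W \ B) \ X) ∪
      ((B ∪ X) ×ˢ W ∪ W ×ˢ (B ∪ X)) := by
    rintro ⟨x, y⟩ hp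
    simp only [SimpleGraph.mem_interedges_iff, mem_union, mem_pairsMeeting, mem_product, mem_sdiff,
      avoid, mem_compl] at hp ⊢
    tauto
  grw [hcover, card_union_le, card_union_le, card_product, card_product, card_union_le, touch]
  exact le_of_eq (by ring)

namespace MaderDense

theorem touch_eq_zero_of_card_boundary_lt (h : Minimal (MaderDense (2 * lam + 10 * q) q G) W)
    (hBW : B ⊆ W) (hX : X ⊆ W \ B) (hq : #B + #X ≤ q) {D : Finset V} (hD : D ⊆ (W \ B) \ X)
    (hDX : #(boundary (avoid G (W \ B)ᶜ) D) < #X) : touch (avoid G (W \ B)ᶜ) D = 0 := by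
  rcases D.eq_empty_or_nonempty with rfl | ⟨d, hd⟩
  · exact touch_empty _
  exfalso
  have hDB : D ⊆ W \ B := hD.trans sdiff_subset
  have hDW : D ⊆ W := hDB.trans sdiff_subset
  obtain ⟨x, hxX, hxD⟩ := exists_mem_notMem_of_card_lt_card hDX
  have hxDn : x ∉ D := fun hx => (mem_sdiff.1 (hD hx)).2 hxX
  obtain ⟨hxW, hxB⟩ := mem_sdiff.1 (hX hxX)
  set A := D ∪ boundary (avoid G (W \ B)ᶜ) D ∪ B with hA
  have hAW : A ⊆ W := union_subset (union_subset hDW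
    ((boundary_avoid_compl_subset G _ D).trans sdiff_subset)) hBW
  have hnb : ∀ a ∈ D, ∀ b ∈ W, G.Adj a b → b ∈ A := fun a ha b hb hab => by
    by_cases hbB : b ∈ B
    · exact mem_union_right _ hbB
    · exact mem_union_left _
        (mem_union_boundary_avoid_compl hDB ha (mem_sdiff.2 ⟨hb, hbB⟩) hab)
  have hcard₁ : #{w ∈ W | G.Adj d w} ≤ #A := card_le_card fun w hw =>
    hnb d hd w (mem_filter.1 hw).1 (mem_filter.1 hw).2
  have hcard₂ : #{w ∈ W | G.Adj x w} ≤ #(W \ D) := card_le_card fun w hw => by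
    obtain ⟨hwW, hxw⟩ := mem_filter.1 hw
    refine mem_sdiff.2 ⟨hwW, fun hwD => ?_⟩
    exact (mem_union.1 (mem_union_boundary_avoid_compl hDB hwD (hX hxX) hxw.symm)).elim hxDn hxD
  have hdd := lt_two_mul_degree (by omega) h (hDW hd)
  have hdx := lt_two_mul_degree (by omega) h hxW
  have hsep := card_add_lt_of_separation h
    (hAW.ssubset_of_mem_notMem hxW (by simp [hA, hxDn, hxD, hxB]))
    (sdiff_ssubset hDW ⟨d, hd⟩) (by omega) (by omega)
    fun a ha b hb hab => by
      have := hnb a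
      have := hnb b
      grind [G.adj_comm a b]
  have hcardA : #A ≤ #D + #(boundary (avoid G (W \ B)ᶜ) D) + #B := by
    grw [hA, card_union_le, card_union_le]
  have hcardC := card_sdiff_add_card_eq_card hDW
  omega

theorem massed (h : Minimal (MaderDense (2 * lam + 10 * q) q G) W) (hW : W.Nonempty)
    (hBW : B ⊆ W) (hX : X ⊆ W \ B) (hq : #B + #X ≤ q) :
    Massed (2 * lam) (avoid G (W \ B)ᶜ) ((W \ B) \ X) X where
  disjoint := sdiff_disjoint
  boundary_subset v hv := by
    obtain ⟨hvR, d, -, hdv⟩ := mem_boundary.1 hv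
    by_contra hvX
    exact hvR (mem_sdiff.2 ⟨(avoid_compl_adj.1 hdv).2.2, hvX⟩)
  lt_touch := by
    obtain ⟨w, hw⟩ := hW
    have hdeg := lt_two_mul_degree (by omega) h hw
    have hdegW : #{w' ∈ W | G.Adj w w'} ≤ #W := card_filter_le _ _
    have hdense := h.prop.2
    have hR : #((W \ B) \ X) ≤ #W := card_le_card (sdiff_subset.trans sdiff_subset)
    have hΓ : (2 * lam + 10 * q) * q ≤ 2 * #W * q := Nat.mul_le_mul_right _ (by omega)
    grw [card_interedges_le_touch_add G W B X, hq] at hdense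
    grw [hR]
    nlinarith
  touch_le D hD hDX := by
    rw [touch_eq_zero_of_card_boundary_lt h hBW hX hq hD hDX]
    exact Nat.zero_le _

end MaderDense

end MaderLinked

section DenseModel

variable {V : Type u} {ι : Type v} {G : SimpleGraph V} {H : SimpleGraph ι}

theorem MaderDense.linked [Finite V] {W B X : Finset V} {lam q : ℕ}
    (h : Minimal (MaderDense (2 * lam + 10 * q) q G) W) (hW : W.Nonempty) (hBW : B ⊆ W)
    (hX : X ⊆ W \ B) (hq : #B + #X ≤ q) (hlam : 24 * #X + 2 ≤ lam) :
    Linked G (W \ B) X := by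
  have := Fintype.ofFinite V
  exact ((massed h hW hBW hX hq).linked hlam le_rfl).mono (avoid_le _ _)
    (sdiff_union_of_subset hX).subset

theorem exists_walk_of_reachable_monochromatic {S : Finset V} {l : V → ℕ} {x y : V} (hx : x ∈ S)
    (h : (monochromatic G S l).Reachable x y) :
    ∃ p : G.Walk x y, ∀ v ∈ p.support, v ∈ S ∧ l v = l x := by
  obtain ⟨p⟩ := h
  induction p with
  | nil => exact ⟨.nil, by simpa using hx⟩
  | cons hxy _ ih =>
    obtain ⟨q, hq⟩ := ih hxy.2.2.1
    exact ⟨.cons hxy.1 q, by simpa [hx, hxy.2.2.2] using hq⟩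

theorem exists_injective_neighbors {κ : Type*} [Fintype κ] (o : κ → V) {W B : Finset V}
    (h : ∀ k, Fintype.card κ + #B ≤ #{w ∈ W | G.Adj (o k) w}) :
    ∃ τ : κ → V, Function.Injective τ ∧ ∀ k, τ k ∈ W \ B ∧ G.Adj (o k) (τ k) := by
  have hHall : ∀ K : Finset κ, #K ≤ #(K.biUnion fun k => {w ∈ W | G.Adj (o k) w} \ B) :=
    fun K => by
      rcases K.eq_empty_or_nonempty with rfl | ⟨k, hk⟩
      · simp
      grw [← subset_biUnion_of_mem (fun k => {w ∈ W | G.Adj (o k) w} \ B) hk, K.card_le_univ]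
      have := h k
      have : #{w ∈ W | G.Adj (o k) w} ≤ #({w ∈ W | G.Adj (o k) w} \ B) + #B :=
        card_le_card_sdiff_add_card
      omega
  obtain ⟨τ, hinj, hτ⟩ := (all_card_le_biUnion_card_iff_exists_injective _).1 hHall
  refine ⟨τ, hinj, fun k => ?_⟩
  have := hτ k
  simp only [mem_sdiff, mem_filter] at this ⊢
  tauto

variable [Fintype ι]

theorem SubdivisionModel.nonempty_of_linked {b : ι → V} (hb : Function.Injective b) {S : Finset V}
    (hbS : ∀ i, b i ∉ S) {τ : H.Dart → V} (hτ : Function.Injective τ) (hτS : ∀ d, τ d ∈ S)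
    (hadj : ∀ d, G.Adj (b d.fst) (τ d)) (hL : Linked G S (univ.image τ)) :
    Nonempty (SubdivisionModel H G) := by
  obtain ⟨code, hcode⟩ := exists_injective_nat (Sym2 ι)
  obtain ⟨l, hl, hreach⟩ := hL (Function.extend τ (fun d => code d.edge) 0)
  have hτX : ∀ d, τ d ∈ univ.image τ := fun d => mem_image_of_mem _ (mem_univ d)
  have hlτ : ∀ d, l (τ d) = code d.edge := fun d => by rw [hl _ (hτX d), hτ.extend_apply]
  refine ⟨⟨b, hb, fun e => b '' {i | i ∈ e} ∪ {v | v ∈ S ∧ l v = code e}, fun i j hij => ?_,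
    fun e _ i hi => ?_, fun e _ e' _ hne => ?_⟩⟩
  · let d : H.Dart := ⟨(i, j), hij⟩
    have hd : d.symm.edge = d.edge := d.edge_symm
    obtain ⟨p, hp⟩ := exists_walk_of_reachable_monochromatic (hτS d) <|
      hreach _ (hτX d) _ (hτX d.symm) (by rw [hτ.extend_apply, hτ.extend_apply, hd])
    have hi : G.Adj (b i) (τ d) := hadj d
    have hj : G.Adj (τ d.symm) (b j) := (hadj d.symm).symm
    refine ⟨.cons hi (p.concat hj), fun v hv => ?_⟩
    simp only [SimpleGraph.Walk.support_cons, SimpleGraph.Walk.support_concat, List.mem_cons,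
      List.mem_append, List.not_mem_nil, or_false] at hv
    rcases hv with rfl | hv | rfl
    · exact Or.inl ⟨i, Sym2.mem_mk_left i j, rfl⟩
    · exact Or.inr ⟨(hp v hv).1, (hp v hv).2.trans (hlτ d)⟩
    · exact Or.inl ⟨j, Sym2.mem_mk_right i j, rfl⟩
  · rcases hi with ⟨i', hi', hii'⟩ | ⟨hi, -⟩
    · exact hb hii' ▸ hi'
    · exact absurd hi (hbS i)
  · rintro v ⟨hv | hv, hv' | hv'⟩
    · exact Set.image_subset_range _ _ hv
    · exact Set.image_subset_range _ _ hv
    · exact Set.image_subset_range _ _ hv'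
    · exact absurd (hcode (hv.2.symm.trans hv'.2)) hne

/-- An average degree that forces a subdivision of `H`. It is linear in the numbers of edges and
vertices of `H`. -/
def denseBound (H : SimpleGraph ι) : ℕ := 116 * #H.edgeFinset + 10 * Fintype.card ι + 4

theorem SubdivisionModel.nonempty_of_dense [Finite V] [Nonempty ι] {W₀ : Finset V}
    (hW₀ : W₀.Nonempty) (h : denseBound H * #W₀ ≤ #(G.interedges W₀ W₀)) :
    Nonempty (SubdivisionModel H G) := by
  set k := Fintype.card H.Dart
  have hkE : k = 2 * #H.edgeFinset := H.dart_card_eq_twice_card_edges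
  have hι : 0 < Fintype.card ι := Fintype.card_pos
  have hΓ : denseBound H = 2 * (24 * k + 2) + 10 * (k + Fintype.card ι) := by
    rw [denseBound, hkE]; ring
  obtain ⟨W, -, hmin⟩ := exists_minimal_le_of_wellFoundedLT _ W₀ <|
    maderDense_of_mul_le (q := k + Fintype.card ι) (by omega) (by omega) hW₀ (hΓ ▸ h)
  have hWcard := hmin.prop.card_lt (by omega)
  have hdeg : ∀ v ∈ W, k + Fintype.card ι ≤ #{w ∈ W | G.Adj v w} := fun v hv => by
    have := MaderDense.lt_two_mul_degree (by omega) hmin hv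
    omega
  obtain ⟨b⟩ : Nonempty (ι ↪ W) := Function.Embedding.nonempty_of_card_le (by
    rw [Fintype.card_coe]; omega)
  have hb : Function.Injective fun i => (b i : V) := Subtype.val_injective.comp b.injective
  set B := univ.image fun i => (b i : V)
  have hbB : ∀ i, (b i : V) ∈ B := fun i => mem_image_of_mem _ (mem_univ i)
  have hBW : B ⊆ W := image_subset_iff.2 fun i _ => (b i).2
  have hBcard : #B ≤ Fintype.card ι := card_image_le
  obtain ⟨τ, hτ, hτW⟩ := exists_injective_neighbors (fun d : H.Dart => (b d.fst : V))
    (B := B) fun d => (Nat.add_le_add_left hBcard _).trans (hdeg _ (b d.fst).2)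
  have hXcard : #(univ.image τ) ≤ k := card_image_le
  exact SubdivisionModel.nonempty_of_linked hb (fun i hi => (mem_sdiff.1 hi).2 (hbB i)) hτ
    (fun d => (hτW d).1) (fun d => (hτW d).2) <|
    MaderDense.linked hmin (card_pos.1 (by omega)) hBW (image_subset_iff.2 fun d _ => (hτW d).1)
      (by omega) (by omega)

end DenseModel

/-! ### Sparse graphs -/

section Sparse

variable {V : Type u} {D : SimpleGraph V} {Γ s : ℕ}

/-- Every subgraph of `D` has average degree at most `Γ`; `#(D.interedges W W)` is the sum of the
degrees in the subgraph that `D` induces on `W`. -/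
def Sparse (Γ : ℕ) (D : SimpleGraph V) : Prop :=
  ∀ W : Finset V, #(D.interedges W W) ≤ Γ * #W

theorem sparse_denseBound [Finite V] {ι : Type v} [Fintype ι] [Nonempty ι] {H : SimpleGraph ι}
    (h : IsEmpty (SubdivisionModel H D)) : Sparse (denseBound H) D := fun W => by
  rcases W.eq_empty_or_nonempty with rfl | hW
  · simp
  · by_contra! hcon
    exact not_nonempty_iff.2 h (SubdivisionModel.nonempty_of_dense hW hcon.le)

theorem card_interedges_eq_sum (D : SimpleGraph V) (A C : Finset V) :
    #(D.interedges A C) = ∑ a ∈ A, #{c ∈ C | D.Adj a c} := by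
  simp only [SimpleGraph.interedges_def, card_filter, sum_product]

/-- The cliques of `D` on `s` vertices of `W`. -/
def cliques (D : SimpleGraph V) (s : ℕ) (W : Finset V) : Finset (Finset V) :=
  {K ∈ W.powersetCard s | D.IsClique (K : Set V)}

theorem mem_cliques {W K : Finset V} : K ∈ cliques D s W ↔ (K ⊆ W ∧ #K = s) ∧ D.IsClique K := by
  simp [cliques]

namespace Sparse

theorem exists_degree_le (hD : Sparse Γ D) {W : Finset V} (hW : W.Nonempty) :
    ∃ v ∈ W, #{w ∈ W | D.Adj v w} ≤ Γ := by
  refine exists_le_of_sum_le hW ?_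
  rw [← card_interedges_eq_sum, sum_const, smul_eq_mul, mul_comm]
  exact hD W

theorem mul_card_le (hD : Sparse Γ D) {B W : Finset V} (hBW : B ⊆ W) {n : ℕ}
    (h : ∀ b ∈ B, n ≤ #{w ∈ W | D.Adj b w}) : n * #B ≤ Γ * #W := calc
  n * #B ≤ ∑ b ∈ B, #{w ∈ W | D.Adj b w} := by
    rw [mul_comm, ← smul_eq_mul]
    exact card_nsmul_le_sum _ _ _ h
  _ = #(D.interedges B W) := (card_interedges_eq_sum D B W).symm
  _ ≤ #(D.interedges W W) := card_le_card (SimpleGraph.interedges_mono D hBW subset_rfl)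
  _ ≤ Γ * #W := hD W

theorem card_cliques_le (hD : Sparse Γ D) (hs : 1 ≤ s) (W : Finset V) :
    #(cliques D s W) ≤ #W * Γ ^ (s - 1) := by
  induction W using Finset.strongInduction with
  | H W ih =>
  rcases W.eq_empty_or_nonempty with rfl | hW
  · simp [cliques, powersetCard_eq_empty.2 (show #(∅ : Finset V) < s from hs)]
  obtain ⟨v, hv, hdeg⟩ := hD.exists_degree_le hW
  have hcover : cliques D s W ⊆ cliques D s (W.erase v) ∪
      (powersetCard (s - 1) {w ∈ W | D.Adj v w}).image (insert v) := fun K hK => by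
    obtain ⟨⟨hKW, hKs⟩, hK⟩ := mem_cliques.1 hK
    by_cases hvK : v ∈ K
    · refine mem_union_right _ (mem_image.2
        ⟨K.erase v, mem_powersetCard.2 ⟨fun x hx => ?_, ?_⟩, insert_erase hvK⟩)
      · obtain ⟨hxv, hxK⟩ := mem_erase.1 hx
        exact mem_filter.2 ⟨hKW hxK, hK hvK hxK hxv.symm⟩
      · rw [card_erase_of_mem hvK, hKs]
    · exact mem_union_left _ (mem_cliques.2 ⟨⟨subset_erase.2 ⟨hKW, hvK⟩, hKs⟩, hK⟩)
  have hnbrs : #(powersetCard (s - 1) {w ∈ W | D.Adj v w}) ≤ Γ ^ (s - 1) := by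
    rw [card_powersetCard]
    exact (Nat.choose_le_pow _ _).trans (Nat.pow_le_pow_left hdeg _)
  grw [hcover, card_union_le, card_image_le, ih _ (erase_ssubset hv), hnbrs, ← add_one_mul,
    card_erase_add_one hv]

end Sparse

end Sparse

section MaximalSubdivision

variable {V : Type u} {G : SimpleGraph V} {B : Finset V} {M : Finset (V × Sym2 V)}

theorem subdividesOnce_empty : SubdividesOnce G B ∅ := by
  constructor <;> simp

namespace SubdividesOnce

theorem insert (hM : SubdividesOnce G B M) {a x y : V} (ha : a ∉ B) (hx : x ∈ B) (hy : y ∈ B)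
    (hxy : x ≠ y) (hax : G.Adj a x) (hay : G.Adj a y) (haM : ∀ e, (a, e) ∉ M)
    (hxyM : ∀ a', (a', s(x, y)) ∉ M) : SubdividesOnce G B (insert (a, s(x, y)) M) where
  notMem := forall_mem_insert _ _ _ |>.2 ⟨ha, hM.notMem⟩
  not_isDiag := forall_mem_insert _ _ _ |>.2 ⟨hxy, hM.not_isDiag⟩
  mem := forall_mem_insert _ _ _ |>.2 ⟨Sym2.ball.2 ⟨hx, hy⟩, hM.mem⟩
  adj := forall_mem_insert _ _ _ |>.2 ⟨Sym2.ball.2 ⟨hax, hay⟩, hM.adj⟩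
  injOn_fst := by
    rw [coe_insert, Set.injOn_insert (haM _)]
    exact ⟨hM.injOn_fst, by simpa using haM⟩
  injOn_snd := by
    rw [coe_insert, Set.injOn_insert (haM _)]
    exact ⟨hM.injOn_snd, by simpa using hxyM⟩

theorem adj_of_maximal (hM : Maximal (SubdividesOnce G B) M) {a x y : V} (ha : a ∉ B)
    (haM : a ∉ M.image Prod.fst) (hx : x ∈ B) (hy : y ∈ B) (hxy : x ≠ y) (hax : G.Adj a x)
    (hay : G.Adj a y) : (subdividedGraph M).Adj x y := by
  refine subdividedGraph_adj.2 ⟨?_, hxy⟩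
  by_contra! hxyM
  have haM' : ∀ e, (a, e) ∉ M := fun e he => haM (mem_image_of_mem Prod.fst he)
  exact haM' _ <| hM.le_of_ge (hM.prop.insert ha hx hy hxy hax hay haM' hxyM) (subset_insert _ _)
    (mem_insert_self _ _)

theorem card_le (hM : SubdividesOnce G B M) : #M ≤ #((subdividedGraph M).interedges B B) := by
  rw [← card_image_of_injOn hM.injOn_snd]
  have hcover : M.image Prod.snd ⊆ ((subdividedGraph M).interedges B B).image Sym2.mk.uncurry := by
    simp only [image_subset_iff]
    rintro ⟨a, x, y⟩ hp
    refine mem_image.2 ⟨(x, y), (SimpleGraph.mem_interedges_iff _).2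
      ⟨hM.mem _ hp _ (Sym2.mem_mk_left x y), hM.mem _ hp _ (Sym2.mem_mk_right x y), ?_⟩, rfl⟩
    exact subdividedGraph_adj.2 ⟨⟨a, hp⟩, hM.not_isDiag _ hp⟩
  grw [hcover, card_image_le]

end SubdividesOnce

theorem card_le_mul_of_isEmpty_subdivisionModel {s t : ℕ}
    (hG : IsEmpty (SubdivisionModel (completeBipartiteGraph (Fin s) (Fin t)) G)) {A : Finset V}
    {Q : Finset (Finset V)} {κ : V → Finset V} (hκ : ∀ a ∈ A, κ a ∈ Q) (hs : ∀ a ∈ A, #(κ a) = s)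
    (h : ∀ a ∈ A, ∀ x ∈ κ a, G.Adj a x) : #A ≤ t * #Q := by
  refine card_le_mul_card_image_of_maps_to hκ t fun K _ => ?_
  by_contra! hcon
  obtain ⟨a, ha⟩ := card_pos.1 (Nat.zero_lt_of_lt hcon)
  obtain ⟨T, hT, hTt⟩ := exists_subset_card_eq hcon.le
  refine not_nonempty_iff.2 hG <| SubdivisionModel.nonempty_of_isContained <|
    SimpleGraph.completeBipartiteGraph_isContained_iff.2 ⟨K, T, ?_, ?_, fun x hx y hy => ?_⟩
  · obtain ⟨haA, rfl⟩ := mem_filter.1 ha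
    rw [hs a haA, Fintype.card_fin]
  · rw [hTt, Fintype.card_fin]
  · obtain ⟨hyA, rfl⟩ := mem_filter.1 (hT hy)
    exact (h y hyA x hx).symm

theorem exists_adj_completeBipartiteGraph {α : Type*} {β : Type*} [Nonempty α] [Nonempty β] :
    ∀ a, ∃ b, (completeBipartiteGraph α β).Adj a b := by
  inhabit α
  inhabit β
  rintro (a | b)
  exacts [⟨.inr default, by simp⟩, ⟨.inl default, by simp⟩]

theorem card_le_mul_card_of_degree_le [Finite V] {s t : ℕ} (hs : 1 ≤ s) (ht : 1 ≤ t)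
    (hG : IsEmpty (SubdivisionModel (completeBipartiteGraph (Fin s) (Fin t)) G)) {A : Finset V}
    (hAB : Disjoint A B) (hdeg : ∀ a ∈ A, s ≤ #{x ∈ B | G.Adj a x}) :
    #A ≤ (denseBound (completeBipartiteGraph (Fin s) (Fin t)) +
      t * denseBound (completeBipartiteGraph (Fin s) (Fin t)) ^ (s - 1)) * #B := by
  have : Nonempty (Fin s) := ⟨⟨0, hs⟩⟩
  have : Nonempty (Fin t) := ⟨⟨0, ht⟩⟩
  set Γ := denseBound (completeBipartiteGraph (Fin s) (Fin t))
  obtain ⟨M, -, hM⟩ := Finite.exists_le_maximal (subdividesOnce_empty (G := G) (B := B))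
  have hD : Sparse Γ (subdividedGraph M) := sparse_denseBound <| not_nonempty_iff.1 fun h =>
    not_nonempty_iff.2 hG (hM.prop.nonempty_subdivisionModel exists_adj_completeBipartiteGraph h)
  have hused : #(M.image Prod.fst) ≤ Γ * #B :=
    card_image_le.trans (hM.prop.card_le.trans (hD B))
  -- By maximality, the neighbours of an unused vertex of `A` form a clique.
  have hunused : ∀ a ∈ A \ M.image Prod.fst, ∃ K ∈ cliques (subdividedGraph M) s B,
      ∀ x ∈ K, G.Adj a x := fun a ha => by
    obtain ⟨haA, haM⟩ := mem_sdiff.1 ha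
    obtain ⟨K, hK, hKs⟩ := exists_subset_card_eq (hdeg a haA)
    have hKB : ∀ x ∈ K, x ∈ B ∧ G.Adj a x := fun x hx => mem_filter.1 (hK hx)
    refine ⟨K, mem_cliques.2 ⟨⟨fun x hx => (hKB x hx).1, hKs⟩,
      fun x hx y hy hxy => ?_⟩, fun x hx => (hKB x hx).2⟩
    exact SubdividesOnce.adj_of_maximal hM (disjoint_left.1 hAB haA) haM (hKB x hx).1 (hKB y hy).1
      hxy (hKB x hx).2 (hKB y hy).2
  choose! κ hκ hκG using hunused
  have hcard := card_le_mul_of_isEmpty_subdivisionModel hG hκ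
    (fun a ha => (mem_cliques.1 (hκ a ha)).1.2) hκG
  calc #A ≤ #(A \ M.image Prod.fst) + #(M.image Prod.fst) := card_le_card_sdiff_add_card
    _ ≤ t * (#B * Γ ^ (s - 1)) + Γ * #B := by grw [hcard, hused, hD.card_cliques_le hs B]
    _ = (Γ + t * Γ ^ (s - 1)) * #B := by ring

end MaximalSubdivision

/-! ### Light edges and defective colourings -/

section HasDefect

variable {V : Type u} {α : Type v} {G : SimpleGraph V} {c : V → α} {n : ℕ}

theorem hasDefect_bot : HasDefect (⊥ : SimpleGraph V) c n := fun x => by simp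

theorem hasDefect_of_deleteEdges [Fintype V] {a b : V} (ha : G.degree a ≤ n) (hb : G.degree b ≤ n)
    (h : HasDefect (G.deleteEdges {s(a, b)}) c n) : HasDefect G c n := fun x => by
  by_cases hx : G.degree x ≤ n
  · calc {y | G.Adj x y ∧ c y = c x}.encard ≤ (G.neighborFinset x : Set V).encard :=
          Set.encard_le_encard fun y hy => (G.mem_neighborFinset x y).2 hy.1
      _ = G.degree x := Set.encard_coe_eq_coe_finsetCard _
      _ ≤ n := by exact_mod_cast hx
  · refine (Set.encard_le_encard ?_).trans (h x)
    rintro y ⟨hxy, hc⟩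
    refine ⟨SimpleGraph.deleteEdges_adj.2 ⟨hxy, fun heq => ?_⟩, hc⟩
    rcases Sym2.mem_iff.1 (heq ▸ Sym2.mem_mk_left x y : x ∈ s(a, b)) with rfl | rfl
    exacts [hx ha, hx hb]

theorem hasDefect_update {v : V} {k : α} (hk : ∀ y, G.Adj v y → c y ≠ k)
    (h : HasDefect (avoid G {v}) c n) : HasDefect G (Function.update c v k) n := fun x => by
  rcases eq_or_ne x v with rfl | hx
  · refine le_of_eq_of_le (Set.encard_eq_zero.2 <| Set.eq_empty_of_forall_notMem ?_) zero_le
    rintro y ⟨hxy, hc⟩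
    rw [Function.update_self, Function.update_of_ne hxy.ne'] at hc
    exact hk y hxy hc
  · refine (Set.encard_le_encard ?_).trans (h x)
    rintro y ⟨hxy, hc⟩
    have hy : y ≠ v := by
      rintro rfl
      rw [Function.update_self, Function.update_of_ne hx] at hc
      exact hk x hxy.symm hc.symm
    rw [Function.update_of_ne hx, Function.update_of_ne hy] at hc
    exact ⟨⟨hxy, by simpa using hx, by simpa using hy⟩, hc⟩

end HasDefect

section LightEdge

variable {V : Type u} {G : SimpleGraph V}

theorem isChoosable_of_forall_exists_light [Fintype V] {s n : ℕ} (hs : 1 ≤ s)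
    (h : ∀ G' ≤ G, G' ≠ ⊥ → (∀ v w, G'.Adj v w → s ≤ G'.degree v) →
      ∃ a b, G'.Adj a b ∧ G'.degree a ≤ n ∧ G'.degree b ≤ n) : IsChoosable G s n := by
  intro α L hL
  induction G using WellFoundedLT.induction with
  | ind G ih =>
  have ih' : ∀ G' < G, ∃ c : V → α, (∀ x, c x ∈ L x) ∧ HasDefect G' c n := fun G' hG' =>
    ih G' hG' fun G'' hG'' => h G'' (hG''.trans hG'.le)
  rcases eq_or_ne G ⊥ with rfl | hG
  · have hne : ∀ x, ∃ k, k ∈ L x := fun x => card_pos.1 (by rw [hL]; exact hs)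
    choose c hc using hne
    exact ⟨c, hc, hasDefect_bot⟩
  by_cases hdeg : ∀ v w, G.Adj v w → s ≤ G.degree v
  · obtain ⟨a, b, hab, ha, hb⟩ := h G le_rfl hG hdeg
    obtain ⟨c, hc, hcn⟩ := ih' (G.deleteEdges {s(a, b)}) <| (G.deleteEdges_le _).lt_of_ne
      fun heq => (SimpleGraph.deleteEdges_adj.1 (heq.ge hab)).2 rfl
    exact ⟨c, hc, hasDefect_of_deleteEdges ha hb hcn⟩
  · push Not at hdeg
    obtain ⟨v, w, hvw, hv⟩ := hdeg
    obtain ⟨c, hc, hcn⟩ := ih' (avoid G {v}) <| (avoid_le G {v}).lt_of_ne fun heq =>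
      (heq.ge hvw).2.1 (mem_singleton_self v)
    obtain ⟨k, hkL, hk⟩ := exists_mem_notMem_of_card_lt_card
      (show #((G.neighborFinset v).image c) < #(L v) by rw [hL]; exact card_image_le.trans_lt hv)
    refine ⟨Function.update c v k, fun x => ?_, hasDefect_update (fun y hy hyk => hk ?_) hcn⟩
    · rcases eq_or_ne x v with rfl | hx
      · rwa [Function.update_self]
      · rw [Function.update_of_ne hx]
        exact hc x
    · exact mem_image.2 ⟨y, (G.mem_neighborFinset v y).2 hy, hyk⟩

/-- The defect with which graphs without a `K_{s,t}` topological minor are `s`-choosable here. -/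
def defectBound (s t : ℕ) : ℕ :=
  denseBound (completeBipartiteGraph (Fin s) (Fin t)) *
    (denseBound (completeBipartiteGraph (Fin s) (Fin t)) +
      t * denseBound (completeBipartiteGraph (Fin s) (Fin t)) ^ (s - 1) + 1)

theorem exists_light_edge [Fintype V] {s t : ℕ} (hs : 1 ≤ s) (ht : 1 ≤ t)
    (hG : IsEmpty (SubdivisionModel (completeBipartiteGraph (Fin s) (Fin t)) G)) (hne : G ≠ ⊥)
    (hdeg : ∀ v w, G.Adj v w → s ≤ G.degree v) :
    ∃ a b, G.Adj a b ∧ G.degree a ≤ defectBound s t ∧ G.degree b ≤ defectBound s t := by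
  by_contra! hheavy
  have : Nonempty (Fin s) := ⟨⟨0, hs⟩⟩
  set Γ := denseBound (completeBipartiteGraph (Fin s) (Fin t))
  set n := defectBound s t with hn
  let B : Finset V := {v | n < G.degree v}
  let A : Finset V := {v | G.degree v ≤ n ∧ ∃ w, G.Adj v w}
  have hmemB : ∀ v, v ∈ B ↔ n < G.degree v := by simp [B]
  have hmemA : ∀ v, v ∈ A ↔ G.degree v ≤ n ∧ ∃ w, G.Adj v w := by simp [A]
  have hAB : Disjoint A B := disjoint_left.2 fun v hvA hvB =>
    ((hmemB v).1 hvB).not_ge ((hmemA v).1 hvA).1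
  have hA : #A ≤ (Γ + t * Γ ^ (s - 1)) * #B := by
    refine card_le_mul_card_of_degree_le hs ht hG hAB fun a ha => ?_
    obtain ⟨han, w, haw⟩ := (hmemA a).1 ha
    refine (hdeg a w haw).trans (card_le_card fun x hx => ?_)
    have hax := (G.mem_neighborFinset a x).1 hx
    exact mem_filter.2 ⟨(hmemB x).2 (hheavy a x hax han), hax⟩
  have hupper : (n + 1) * #B ≤ Γ * (#A + #B) := by
    grw [← card_union_le]
    refine (sparse_denseBound hG).mul_card_le subset_union_right fun b hb =>
      ((hmemB b).1 hb).trans_le (card_le_card fun x hx => ?_)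
    have hbx := (G.mem_neighborFinset b x).1 hx
    rw [mem_filter, mem_union, hmemA, hmemB]
    exact ⟨(le_or_gt _ _).imp_left fun hxn => ⟨hxn, b, hbx.symm⟩, hbx⟩
  obtain ⟨b, hb⟩ : B.Nonempty := by
    obtain ⟨a, b, hab⟩ := SimpleGraph.ne_bot_iff_exists_adj.1 hne
    by_cases ha : G.degree a ≤ n
    · exact ⟨b, (hmemB b).2 (hheavy a b hab ha)⟩
    · exact ⟨a, (hmemB a).2 (not_le.1 ha)⟩
  have hB : 0 < #B := card_pos.2 ⟨b, hb⟩
  have hlower : Γ * (#A + #B) ≤ n * #B := by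
    grw [hA, hn, defectBound]
    exact le_of_eq (by ring)
  nlinarith

theorem isChoosable_defectBound [Finite V] {s t : ℕ} (hs : 1 ≤ s) (ht : 1 ≤ t)
    (hG : KstTopologicalMinorFree s t V G) : IsChoosable G s (defectBound s t) := by
  have := Fintype.ofFinite V
  refine isChoosable_of_forall_exists_light hs fun G' hG' hne hdeg =>
    exists_light_edge hs ht (not_nonempty_iff.1 fun h => ?_) hne hdeg
  obtain ⟨M⟩ := SubdivisionModel.nonempty_mono hG' h
  exact hG M.isTopologicalMinor

end LightEdge

/-! ### Closures of trees -/

section BranchVertices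

variable {V : Type u} {G : SimpleGraph V} {α β : Type*}

theorem reachable_avoid_of_walk {Z : Finset V} {x y : V} (p : G.Walk x y)
    (hp : ∀ v ∈ p.support, v ∉ Z) : (avoid G Z).Reachable x y :=
  ⟨p.transfer (avoid G Z) fun e he => by
    induction e with
    | h a b => exact ⟨p.adj_of_mem_edges he, hp _ (p.fst_mem_support_of_mem_edges he),
        hp _ (p.snd_mem_support_of_mem_edges he)⟩⟩

theorem exists_disjoint_of_card_lt [Fintype α] {Z : Finset V} (hZ : #Z < Fintype.card α)
    {S : α → Set V} (hS : Pairwise (Function.onFun Disjoint S)) : ∃ i, ∀ z ∈ Z, z ∉ S i := by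
  by_contra! h
  choose z hz hzS using h
  obtain ⟨i, -, i', -, hne, heq⟩ :=
    exists_ne_map_eq_of_card_lt_of_maps_to (s := univ) hZ fun i _ => hz i
  exact Set.disjoint_left.1 (hS hne) (hzS i) (heq ▸ hzS i')

theorem IsTopologicalMinor.exists_walks
    (h : IsTopologicalMinor (completeBipartiteGraph α β) G) :
    ∃ (f : α ⊕ β → V) (P : ∀ i j, G.Walk (f (.inl i)) (f (.inr j))), Function.Injective f ∧
      ∀ i j i' j' x, x ∈ (P i j).support → x ∈ (P i' j').support → (i, j) ≠ (i', j') →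
        (x = f (.inl i) ∧ i = i') ∨ (x = f (.inr j) ∧ j = j') := by
  obtain ⟨S, f, P, hf, -, -, hbranch, hinter, -, -⟩ := h
  have hadj : ∀ i j, (completeBipartiteGraph α β).Adj (.inl i) (.inr j) := by simp
  refine ⟨f, fun i j => P _ _ (hadj i j), hf, fun i j i' j' x hx hx' hne => ?_⟩
  have hne' : s(Sum.inl i, Sum.inr j) ≠ s(Sum.inl i', Sum.inr j') := by simpa using hne
  obtain ⟨w, rfl⟩ := hinter _ _ (hadj i j) _ _ (hadj i' j') hne' x hx hx'
  have hw := hbranch _ _ _ w hx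
  have hw' := hbranch _ _ _ w hx'
  grind

theorem IsTopologicalMinor.exists_reachable_avoid [Fintype α] [Fintype β]
    (h : IsTopologicalMinor (completeBipartiteGraph α β) G) :
    ∃ f : α ⊕ β → V, Function.Injective f ∧
      ∀ Z : Finset V, #Z < Fintype.card α → #Z < Fintype.card β →
        ∀ a b, f a ∉ Z → f b ∉ Z → (avoid G Z).Reachable (f a) (f b) := by
  obtain ⟨f, P, hf, hP⟩ := h.exists_walks
  refine ⟨f, hf, fun Z hα hβ => ?_⟩
  obtain ⟨i₀, hi₀⟩ := exists_disjoint_of_card_lt hα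
    (S := fun i => {x | ∃ j, x ∈ (P i j).support ∧ x ≠ f (.inr j)}) fun i i' hne =>
      Set.disjoint_left.2 fun x ⟨j, hx, _⟩ ⟨j', hx', _⟩ => by grind
  have hright : ∀ j, f (.inr j) ∉ Z → (avoid G Z).Reachable (f (.inl i₀)) (f (.inr j)) :=
    fun j hj => reachable_avoid_of_walk (P i₀ j) fun v hv hvZ =>
      hi₀ v hvZ ⟨j, hv, fun hvj => hj (hvj ▸ hvZ)⟩
  have hleft : ∀ i, f (.inl i) ∉ Z → (avoid G Z).Reachable (f (.inl i₀)) (f (.inl i)) :=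
    fun i hi => by
      obtain ⟨j₀, hj₀⟩ := exists_disjoint_of_card_lt hβ
        (S := fun j => {x | x ∈ (P i j).support ∧ x ≠ f (.inl i)}) fun j j' hne =>
          Set.disjoint_left.2 fun x ⟨hx, hxi⟩ ⟨hx', _⟩ => by grind
      have hZ : ∀ v ∈ (P i j₀).support, v ∉ Z := fun v hv hvZ =>
        hj₀ v hvZ ⟨hv, fun hvi => hi (hvi ▸ hvZ)⟩
      exact (hright j₀ (hZ _ (P i j₀).end_mem_support)).trans
        (reachable_avoid_of_walk (P i j₀) hZ).symm
  have hall : ∀ a, f a ∉ Z → (avoid G Z).Reachable (f (.inl i₀)) (f a) :=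
    Sum.forall.2 ⟨hleft, hright⟩
  exact fun a b ha hb => (hall a ha).symm.trans (hall b hb)

end BranchVertices

section TreeClosure

variable {s t d : ℕ}

/-- The vertices of the rooted tree in which each vertex at height less than `s - 1` has `d + 1`
children. A vertex is encoded by the path that leads to it from the root. -/
abbrev TreeVertex (s d : ℕ) : Type u := ULift.{u} {l : List (Fin (d + 1)) // l.length < s}

instance (s d : ℕ) : Finite (TreeVertex.{u} s d) := by
  have : Finite {l : List (Fin (d + 1)) // l.length < s} :=
    (List.finite_length_lt (Fin (d + 1)) s).to_subtype
  infer_instance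

/-- The path that leads from the root of the tree to `x`. -/
def treePath (x : TreeVertex.{u} s d) : List (Fin (d + 1)) := x.down.1

theorem length_treePath_lt (x : TreeVertex.{u} s d) : (treePath x).length < s := x.down.2

theorem treePath_injective : Function.Injective (treePath : TreeVertex.{u} s d → _) :=
  Subtype.val_injective.comp ULift.down_injective

/-- The closure of a rooted tree: two vertices are adjacent if one is an ancestor of the other. -/
def treeClosure (s d : ℕ) : SimpleGraph (TreeVertex.{u} s d) where
  Adj x y := x ≠ y ∧ (treePath x <+: treePath y ∨ treePath y <+: treePath x)
  symm := ⟨fun _ _ h => ⟨h.1.symm, h.2.symm⟩⟩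
  loopless := ⟨fun _ h => h.1 rfl⟩

theorem exists_not_prefix_treePath {α : Type*} [Fintype α] (hα : s < Fintype.card α)
    (f : α → TreeVertex.{u} s d) (hf : Function.Injective f) :
    ∃ a b, ¬ treePath (f a) <+: treePath (f b) ∧ ¬ treePath (f b) <+: treePath (f a) := by
  obtain ⟨a, b, hne, heq⟩ := Fintype.exists_ne_map_eq_of_card_lt
    (fun a => (⟨(treePath (f a)).length, length_treePath_lt (f a)⟩ : Fin s)) (by simpa using hα)
  have hlen : (treePath (f a)).length = (treePath (f b)).length := Fin.mk.inj heq
  exact ⟨a, b, fun h => hne (hf (treePath_injective (h.eq_of_length hlen))),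
    fun h => hne (hf (treePath_injective (h.eq_of_length hlen.symm))).symm⟩

/-- The common ancestors of `x` and `y`. -/
def commonAncestors (x y : TreeVertex.{u} s d) : Finset (TreeVertex.{u} s d) :=
  (Set.toFinite {z | treePath z <+: treePath x ∧ treePath z <+: treePath y}).toFinset

theorem mem_commonAncestors {x y z : TreeVertex.{u} s d} :
    z ∈ commonAncestors x y ↔ treePath z <+: treePath x ∧ treePath z <+: treePath y := by
  simp [commonAncestors]

theorem card_commonAncestors_lt {x y : TreeVertex.{u} s d} (h : ¬ treePath x <+: treePath y) :
    #(commonAncestors x y) < s := by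
  suffices #(commonAncestors x y) ≤ #(range (treePath x).length) from
    this.trans_lt (card_range _ ▸ length_treePath_lt x)
  refine card_le_card_of_injOn (fun z => (treePath z).length) (fun z hz => ?_)
    fun z hz z' hz' heq => ?_
  · obtain ⟨hzx, hzy⟩ := mem_commonAncestors.1 hz
    refine mem_coe.2 (mem_range.2 (hzx.length_le.lt_of_ne fun heq => h ?_))
    rwa [← hzx.eq_of_length heq]
  · exact treePath_injective <| (List.prefix_of_prefix_length_le (mem_commonAncestors.1 hz).1
      (mem_commonAncestors.1 hz').1 heq.le).eq_of_length heq

theorem not_reachable_avoid_commonAncestors {x y : TreeVertex.{u} s d}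
    (h : ¬ treePath x <+: treePath y) :
    ¬ (avoid (treeClosure s d) (commonAncestors x y)).Reachable x y := by
  -- The vertices below an ancestor of `x` that is not an ancestor of `y` form a union of
  -- components.
  let p : TreeVertex.{u} s d → Prop := fun z =>
    ∃ w, w <+: treePath x ∧ w <+: treePath z ∧ ¬ w <+: treePath y
  have hstep : ∀ a b, (avoid (treeClosure s d) (commonAncestors x y)).Adj a b → p a → p b := by
    rintro a b ⟨⟨-, hab⟩, -, hb⟩ ⟨w, hwx, hwa, hwy⟩
    rcases hab with hab | hba
    · exact ⟨w, hwx, hwa.trans hab, hwy⟩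
    · rcases List.prefix_or_prefix_of_prefix hwa hba with hwb | hbw
      · exact ⟨w, hwx, hwb, hwy⟩
      · exact ⟨treePath b, hbw.trans hwx, List.prefix_rfl, fun hby =>
          hb (mem_commonAncestors.2 ⟨hbw.trans hwx, hby⟩)⟩
  intro hxy
  have hp : p x = p y := eq_of_reachable
    (fun a b hab => propext ⟨hstep a b hab, hstep b a hab.symm⟩) hxy
  obtain ⟨w, -, hwy, hwy'⟩ : p y := hp ▸ ⟨treePath x, List.prefix_rfl, List.prefix_rfl, h⟩
  exact hwy' hwy

theorem kstTopologicalMinorFree_treeClosure (hs : 1 ≤ s) (hst : s ≤ t) :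
    KstTopologicalMinorFree s t _ (treeClosure.{u} s d) := fun h => by
  obtain ⟨f, hf, hreach⟩ := h.exists_reachable_avoid
  obtain ⟨a, b, hab, hba⟩ := exists_not_prefix_treePath (by simp; omega) f hf
  have hcard := card_commonAncestors_lt hab
  refine not_reachable_avoid_commonAncestors hab <|
    hreach _ (by simpa using hcard) (by simpa using hcard.trans_le hst) a b
      (fun ha => hab (mem_commonAncestors.1 ha).2) fun hb => hba (mem_commonAncestors.1 hb).1

theorem exists_child_forall_ne {α : Type v} {c : TreeVertex.{u} s d → α}
    (hc : HasDefect (treeClosure s d) c d) (x₀ : TreeVertex.{u} s d) :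
    ∃ i : Fin (d + 1), ∀ x, treePath x₀ ++ [i] <+: treePath x → c x ≠ c x₀ := by
  by_contra! hcon
  choose x hx hxc using hcon
  have hinj : Function.Injective x := fun i i' heq => by
    have := (List.prefix_of_prefix_length_le (heq ▸ hx i) (hx i') (by simp)).eq_of_length (by simp)
    simpa using this
  have hsub : Set.range x ⊆ {y | (treeClosure s d).Adj x₀ y ∧ c y = c x₀} := by
    rintro _ ⟨i, rfl⟩
    refine ⟨⟨fun heq => ?_, Or.inl ((List.prefix_append _ [i]).trans (hx i))⟩, hxc i⟩
    have hlen := (hx i).length_le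
    simp [← heq] at hlen
  have hcard := (Set.encard_le_encard hsub).trans (hc x₀)
  rw [← Set.image_univ, hinj.encard_image, Set.encard_univ, ENat.card_eq_coe_fintype_card,
    Fintype.card_fin, Nat.cast_le] at hcard
  omega

theorem exists_forall_descendant_notMem {α : Type v} {c : TreeVertex.{u} s d → α}
    (hc : HasDefect (treeClosure s d) c d) {k : ℕ} (hk : k < s) :
    ∃ (x₀ : TreeVertex.{u} s d) (C : Finset α), (treePath x₀).length = k ∧ #C = k ∧
      ∀ x, treePath x₀ <+: treePath x → c x ∉ C := by
  induction k with
  | zero => exact ⟨⟨[], hk⟩, ∅, rfl, rfl, by simp⟩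
  | succ k ih =>
    obtain ⟨x₀, C, hx₀, hC, hcC⟩ := ih (by omega)
    obtain ⟨i, hi⟩ := exists_child_forall_ne hc x₀
    have hlen : (treePath x₀ ++ [i]).length = k + 1 := by simp [hx₀]
    refine ⟨⟨treePath x₀ ++ [i], hlen.trans_lt hk⟩, insert (c x₀) C, hlen,
      by rw [card_insert_of_notMem (hcC x₀ List.prefix_rfl), hC], fun x hx => ?_⟩
    rw [mem_insert, not_or]
    exact ⟨hi x hx, hcC x ((List.prefix_append _ [i]).trans hx)⟩

theorem not_isColourable_treeClosure {j : ℕ} (hj : j < s) :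
    ¬ IsColourable (treeClosure.{u} s d) j d := by
  rintro ⟨c, hc⟩
  obtain ⟨x₀, C, -, hC, hcC⟩ := exists_forall_descendant_notMem hc hj
  have hcard := card_le_univ (insert (c x₀) C)
  rw [card_insert_of_notMem (hcC x₀ List.prefix_rfl), Fintype.card_fin] at hcard
  omega

theorem le_of_forall_isColourable {j : ℕ} (hs : 1 ≤ s) (hst : s ≤ t)
    (h : ∀ (V : Type u) [Finite V] (G : SimpleGraph V),
      KstTopologicalMinorFree s t V G → IsColourable G j d) : s ≤ j := by
  by_contra! hj
  exact not_isColourable_treeClosure hj (h _ _ (kstTopologicalMinorFree_treeClosure hs hst))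

end TreeClosure

/-! ### The size of the defect -/

theorem IsChoosable.isColourable {V : Type u} {G : SimpleGraph V} {k d : ℕ}
    (h : IsChoosable G k d) : IsColourable G k d := by
  obtain ⟨c, -, hc⟩ := h (Fin k) (fun _ => univ) fun _ => card_fin k
  exact ⟨c, hc⟩

theorem isChoosable_of_free_one_one {V : Type u} [Finite V] {G : SimpleGraph V}
    (hG : KstTopologicalMinorFree 1 1 V G) : IsChoosable G 1 0 := by
  have := Fintype.ofFinite V
  refine isChoosable_of_forall_exists_light le_rfl fun G' hle hne _ => ?_
  obtain ⟨a, b, hab⟩ := SimpleGraph.ne_bot_iff_exists_adj.1 hne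
  have hcopy : (completeBipartiteGraph (Fin 1) (Fin 1)).IsContained G :=
    SimpleGraph.completeBipartiteGraph_isContained_iff.2
      ⟨{a}, {b}, rfl, rfl, by simpa [SimpleGraph.IsCompleteBetween] using hle hab⟩
  obtain ⟨M⟩ := SubdivisionModel.nonempty_of_isContained hcopy
  exact absurd M.isTopologicalMinor hG

theorem denseBound_completeBipartiteGraph (s t : ℕ) :
    denseBound (completeBipartiteGraph (Fin s) (Fin t)) = 116 * (s * t) + 10 * (s + t) + 4 := by
  have h : (#(completeBipartiteGraph (Fin s) (Fin t)).edgeFinset : ℕ∞) = (s * t : ℕ) := by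
    rw [← Set.encard_coe_eq_coe_finsetCard, SimpleGraph.coe_edgeFinset,
      SimpleGraph.encard_edgeSet_completeBipartiteGraph]
    simp
  rw [denseBound, Nat.cast_inj.1 h, Fintype.card_sum, Fintype.card_fin, Fintype.card_fin]

section

variable {s t : ℕ}

theorem denseBound_completeBipartiteGraph_le (hst : s ≤ t) (ht : 2 ≤ t) :
    denseBound (completeBipartiteGraph (Fin s) (Fin t)) ≤ t ^ 9 := by
  have hs : s * t ≤ t * t := Nat.mul_le_mul_right t hst
  have ht2 : 2 * t ≤ t * t := Nat.mul_le_mul_right t ht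
  have h4 : 2 * 2 ≤ t * t := Nat.mul_le_mul ht ht
  calc denseBound (completeBipartiteGraph (Fin s) (Fin t))
    _ ≤ 2 ^ 7 * (t * t) := by rw [denseBound_completeBipartiteGraph]; omega
    _ ≤ t ^ 7 * (t * t) := Nat.mul_le_mul_right _ (Nat.pow_le_pow_left ht 7)
    _ = t ^ 9 := by ring

theorem defectBound_le (hs : 1 ≤ s) (hst : s ≤ t) (ht : 2 ≤ t) :
    defectBound s t ≤ t ^ (20 * s) := by
  have ht1 : 1 ≤ t := by omega
  have hΓ := denseBound_completeBipartiteGraph_le hst ht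
  rw [defectBound]
  set Γ := denseBound (completeBipartiteGraph (Fin s) (Fin t))
  have hmul : t * Γ ^ (s - 1) ≤ t ^ (9 * s) :=
    calc t * Γ ^ (s - 1) ≤ t * (t ^ 9) ^ (s - 1) := by gcongr
      _ = t ^ (1 + 9 * (s - 1)) := by rw [← pow_mul, pow_add, pow_one]
      _ ≤ t ^ (9 * s) := Nat.pow_le_pow_right ht1 (by omega)
  have hpow : t ^ 9 ≤ t ^ (9 * s) := Nat.pow_le_pow_right ht1 (by omega)
  have hone : 1 ≤ t ^ (9 * s) := Nat.one_le_pow _ _ ht1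
  calc Γ * (Γ + t * Γ ^ (s - 1) + 1) ≤ t ^ 9 * (2 ^ 2 * t ^ (9 * s)) :=
        Nat.mul_le_mul hΓ (by omega)
    _ ≤ t ^ 9 * (t ^ 2 * t ^ (9 * s)) := by gcongr
    _ = t ^ (9 + (2 + 9 * s)) := by rw [pow_add, pow_add]
    _ ≤ t ^ (20 * s) := Nat.pow_le_pow_right ht1 (by omega)

theorem defectBound_le_rpow (hs : 1 ≤ s) (hst : s ≤ t) (ht : 2 ≤ t) :
    (defectBound s t : ℝ) ≤ (2 : ℝ) ^ (20 / Real.log 2 * ((s : ℝ) * Real.log (t : ℝ))) := by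
  have ht0 : (0 : ℝ) < t := by positivity
  have hlog : Real.log 2 ≠ 0 := (Real.log_pos one_lt_two).ne'
  calc (defectBound s t : ℝ) ≤ (t : ℝ) ^ (20 * s) := mod_cast defectBound_le hs hst ht
    _ = Real.exp (Real.log t * (20 * s)) := by
        rw [← Real.rpow_natCast, Real.rpow_def_of_pos ht0]
        push_cast
        rfl
    _ = (2 : ℝ) ^ (20 / Real.log 2 * (s * Real.log t)) := by
        rw [Real.rpow_def_of_pos two_pos]
        congr 1
        field_simp

end

end

end DefectiveColouring

theorem mainTheorem3 :
    (∀ s t : ℕ, 1 ≤ s → s ≤ t →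
      DefectiveColouring.IsDefectiveChromaticNumber
        (DefectiveColouring.KstTopologicalMinorFree.{u} s t) s ∧
      DefectiveColouring.IsDefectiveChoiceNumber
        (DefectiveColouring.KstTopologicalMinorFree.{u} s t) s) ∧
    ∃ C : ℝ, 0 < C ∧ ∀ s t : ℕ, 1 ≤ s → s ≤ t →
      ∃ d : ℕ, (d : ℝ) ≤ (2 : ℝ) ^ (C * ((s : ℝ) * Real.log (t : ℝ))) ∧
        ∀ (V : Type u) [Finite V] (G : SimpleGraph V),
          DefectiveColouring.KstTopologicalMinorFree s t V G →
            DefectiveColouring.IsChoosable G s d := by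
  open DefectiveColouring in
  refine ⟨fun s t hs hst => ?_, 20 / Real.log 2, div_pos (by norm_num) (Real.log_pos one_lt_two),
    fun s t hs hst => ?_⟩
  · have hchoosable (V : Type u) [Finite V] (G : SimpleGraph V)
        (hG : KstTopologicalMinorFree s t V G) : IsChoosable G s (defectBound s t) :=
      isChoosable_defectBound hs (hs.trans hst) hG
    exact ⟨⟨⟨_, fun V _ G hG => (hchoosable V G hG).isColourable⟩,
        fun j ⟨d, hd⟩ => le_of_forall_isColourable hs hst hd⟩,
      ⟨⟨_, hchoosable⟩,
        fun j ⟨d, hd⟩ => le_of_forall_isColourable hs hst fun V _ G hG =>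
          (hd V G hG).isColourable⟩⟩
  · rcases (hs.trans hst).eq_or_lt with rfl | ht
    · obtain rfl : s = 1 := le_antisymm hst hs
      exact ⟨0, by simp, fun V _ G hG => isChoosable_of_free_one_one hG⟩
    · exact ⟨defectBound s t, defectBound_le_rpow hs hst ht, fun V _ G hG =>
        isChoosable_defectBound hs (hs.trans hst) hG⟩
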